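/- Let $(M,L)$ be a Finsler manifold ($M$ a smooth finite-dimensional Hausdorff manifold without boundary; $L:TM\to\mathbb R$ continuous, smooth and positive on the slit tangent bundle $\mathcal TM$, positively homogeneous of degree one on the fibres, with $g$, the fibrewise second derivative of $\tfrac12L^2$, positive definite on $\mathcal TM$). Let $\pi:\mathcal TM\to M$ be the projection, let $\pi$-vector fields be the smooth sections of $\pi^{-1}(TM)\to\mathcal TM$, let $\overline\eta(u)=(u,u)$ be the fundamental one, and let $\rho:T(\mathcal TM)\to\pi^{-1}(TM)$, $\rho=(\pi_{T\mathcal TM},d\pi)$, and $\gamma:\pi^{-1}(TM)\to T(\mathcal TM)$ (vertical lift) be the canonical bundle morphisms. For a linear connection $D$ on $\pi^{-1}(TM)$ with connection map $K(W)=D_W\overline\eta$, call $D$ regular if $T_u(\mathcal TM)=\ker\rho_u\oplus\ker K_u$ for all $u$, and let $\beta=(\rho|_{\ker K})^{-1}$ be its horizontal map. With $\mathbf T(V,W)=D_V\rho W-D_W\rho V-\rho[V,W]$ and $\mathbf K(V,W)\overline Z=-D_VD_W\overline Z+D_WD_V\overline Z+D_{[V,W]}\overline Z$, set $Q(\overline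 X,\overline Y)=\mathbf T(\beta\overline X,\beta\overline Y)$, $T(\overline X,\overline Y)=\mathbf T(\gamma\overline X,\beta\overline Y)$, $R(\overline X,\overline Y)=\mathbf K(\beta\overline X,\beta\overline Y)$, $P(\overline X,\overline Y)=\mathbf K(\beta\overline X,\gamma\overline Y)$, $S(\overline X,\overline Y)=\mathbf K(\gamma\overline X,\gamma\overline Y)$. Let $A$ be a smooth scalar 1-form on $\pi^{-1}(TM)$. The HRF-connection with h-recurrence form $A$ is the regular connection $\overline D$ with (C1) $\overline D_{\bar\beta\overline X}\,g=A(\overline X)g$, (C2) $\overline D_{\gamma\overline X}\,g=0$, (C3) $\overline Q=0$, (C4) $g(\overline T(\overline X,\overline Y),\overline Z)=g(\overline T(\overline X,\overline Z),\overline Y)$, where barred symbols $\bar\beta,\overline Q,\overline T,\overline R,\overline P,\overline S$ refer to $\overline D$. The Cartan connection $\nabla$ is the one for $A=0$; the symbols $\beta,T,R,P,S$ refer to $\nabla$. Let $\overline a$ be defined by $g(\overline a,\overline X)=A(\overline X)$, let $\ell=L^{-1}g(\overline\eta,\cdot)$ and $T(\overline X,\overline Y,\overline Z)=g(T(\overline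 X,\overline Y),\overline Z)$, and put $$N(\overline X,\overline Y)=\tfrac12\{g(\overline X,\overline Y)\overline a-A(\overline X)\overline Y-A(\overline Y)\overline X-L\ell(\overline Y)T(\overline a,\overline X)+T(\overline a,\overline X,\overline Y)\overline\eta+L^2[T(T(\overline a,\overline Y),\overline X)-T(T(\overline X,\overline Y),\overline a)]\},$$ $$\overline X_t=\tfrac12\{A(\overline X)\overline\eta+A(\overline\eta)\overline X-g(\overline X,\overline\eta)\overline a+L^2T(\overline a,\overline X)\}.$$ Then for all $\pi$-vector fields $\overline X,\overline Y,\overline Z$ one has $\bar\beta\overline X=\beta\overline X+\gamma\overline X_t$, and (a) $\overline S(\overline X,\overline Y)\overline Z=S(\overline X,\overline Y)\overline Z$; (b) $\overline P(\overline X,\overline Y)\overline Z=P(\overline X,\overline Y)\overline Z+(\nabla_{\gamma\overline Y}N)(\overline X,\overline Z)+N(T(\overline Y,\overline X),\overline Z)+\tfrac12\{A(\overline\eta)S(\overline X,\overline Y)\overline Z-L\ell(\overline X)S(\overline a,\overline Y)\overline Z+L^2S(T(\overline a,\overline X),\overline Y)\overline Z\}$; (c) $\overline R(\overline X,\overline Y)\overline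 Z=R(\overline X,\overline Y)\overline Z+P(\overline X,\overline Y_t)\overline Z-P(\overline Y,\overline X_t)\overline Z+S(\overline X_t,\overline Y_t)\overline Z+\mathfrak U_{\overline X,\overline Y}\{(\nabla_{\bar\beta\overline Y}N)(\overline X,\overline Z)+N(\overline Y,N(\overline X,\overline Z))+N(T(\overline Y_t,\overline X),\overline Z)\}$, where $\mathfrak U_{\overline X,\overline Y}\{B(\overline X,\overline Y)\}=B(\overline X,\overline Y)-B(\overline Y,\overline X)$. -/

import Mathlib

open Bundle Set
open scoped Manifold ContDiff

noncomputable section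

namespace Finsler

section Pullback

variable (E : Type*) [NormedAddCommGroup E] [NormedSpace ℝ E]
  (M : Type*) [TopologicalSpace M] [ChartedSpace E M] [IsManifold 𝓘(ℝ, E) ∞ M]

/-- The projection `π : TM → M`, as a smooth map. -/
def proj : ContMDiffMap 𝓘(ℝ, E).tangent 𝓘(ℝ, E) (TangentBundle 𝓘(ℝ, E) M) M ∞ :=
  ⟨TotalSpace.proj, contMDiff_proj _⟩

/-- The fibre at `u ∈ TM` of the pullback bundle `π⁻¹(TM)`, that is, `T_{π u} M`. -/
def PiSpace (u : TangentBundle 𝓘(ℝ, E) M) : Type _ := TangentSpace 𝓘(ℝ, E) u.proj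

instance (u : TangentBundle 𝓘(ℝ, E) M) : TopologicalSpace (PiSpace E M u) :=
  inferInstanceAs (TopologicalSpace (TangentSpace 𝓘(ℝ, E) u.proj))

instance (u : TangentBundle 𝓘(ℝ, E) M) : AddCommGroup (PiSpace E M u) :=
  inferInstanceAs (AddCommGroup (TangentSpace 𝓘(ℝ, E) u.proj))

instance (u : TangentBundle 𝓘(ℝ, E) M) : Module ℝ (PiSpace E M u) :=
  inferInstanceAs (Module ℝ (TangentSpace 𝓘(ℝ, E) u.proj))

instance (u : TangentBundle 𝓘(ℝ, E) M) : IsTopologicalAddGroup (PiSpace E M u) :=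
  inferInstanceAs (IsTopologicalAddGroup (TangentSpace 𝓘(ℝ, E) u.proj))

instance (u : TangentBundle 𝓘(ℝ, E) M) : ContinuousSMul ℝ (PiSpace E M u) :=
  inferInstanceAs (ContinuousSMul ℝ (TangentSpace 𝓘(ℝ, E) u.proj))

/- The vector bundle structure of `π⁻¹(TM)` over `TM` is that of the pullback of `TM` by `π`. -/

instance : TopologicalSpace (TotalSpace E (PiSpace E M)) :=
  inferInstanceAs (TopologicalSpace
    (TotalSpace E (proj E M *ᵖ (TangentSpace 𝓘(ℝ, E) : M → Type _))))

instance : FiberBundle E (PiSpace E M) :=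
  inferInstanceAs (FiberBundle E (proj E M *ᵖ (TangentSpace 𝓘(ℝ, E) : M → Type _)))

instance : VectorBundle ℝ E (PiSpace E M) :=
  inferInstanceAs (VectorBundle ℝ E (proj E M *ᵖ (TangentSpace 𝓘(ℝ, E) : M → Type _)))

instance : ContMDiffVectorBundle ∞ E (PiSpace E M) 𝓘(ℝ, E).tangent :=
  inferInstanceAs (ContMDiffVectorBundle ∞ E
    (proj E M *ᵖ (TangentSpace 𝓘(ℝ, E) : M → Type _)) 𝓘(ℝ, E).tangent)

/-- (Not necessarily smooth) sections of the pullback bundle. All geometric notions below use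
their values on the slit tangent bundle only; the values on the zero section are irrelevant. -/
abbrev PiField := (u : TangentBundle 𝓘(ℝ, E) M) → PiSpace E M u

/-- (Not necessarily smooth) vector fields on `TM`. -/
abbrev VField :=
  (u : TangentBundle 𝓘(ℝ, E) M) → TangentSpace 𝓘(ℝ, E).tangent u

/-- (Not necessarily smooth) scalar 1-forms on the pullback bundle. -/
abbrev PiForm := (u : TangentBundle 𝓘(ℝ, E) M) → PiSpace E M u →L[ℝ] ℝ

/-- The slit tangent bundle: the open set of nonzero tangent vectors. -/
def slit : Set (TangentBundle 𝓘(ℝ, E) M) := {u | u.snd ≠ 0}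

variable {E M}

/-- `X` is a `π`-vector field: a section of the pullback bundle, smooth over the slit tangent
bundle. -/
def SmoothPi (X : PiField E M) : Prop :=
  ContMDiffOn 𝓘(ℝ, E).tangent (𝓘(ℝ, E).tangent.prod 𝓘(ℝ, E)) ∞
    (fun u ↦ TotalSpace.mk' E u (X u)) (slit E M)

/-- Smooth scalar `π`-1-forms: those mapping `π`-vector fields to functions that are smooth on the
slit tangent bundle. -/
def SmoothForm (A : PiForm E M) : Prop :=
  ∀ X : PiField E M, SmoothPi X →
    ContMDiffOn 𝓘(ℝ, E).tangent 𝓘(ℝ, ℝ) ∞ (fun u ↦ A u (X u)) (slit E M)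

/-- The bundle morphism `ρ : T(TM) → π⁻¹(TM)`, `ρ = (π_{TM}, dπ)`. -/
def rho (u : TangentBundle 𝓘(ℝ, E) M) :
    TangentSpace 𝓘(ℝ, E).tangent u →L[ℝ] PiSpace E M u :=
  mfderiv 𝓘(ℝ, E).tangent 𝓘(ℝ, E) (proj E M) u

/-- The bundle morphism `γ : π⁻¹(TM) → T(TM)`: the vertical lift, i.e. the derivative at `u` of the
inclusion of the fibre `T_{π u} M` into `TM`. -/
def gamma (u : TangentBundle 𝓘(ℝ, E) M) :
    PiSpace E M u →L[ℝ] TangentSpace 𝓘(ℝ, E).tangent u :=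
  mfderiv 𝓘(ℝ, E) 𝓘(ℝ, E).tangent
    (fun v : E ↦ (⟨u.proj, v⟩ : TangentBundle 𝓘(ℝ, E) M)) u.snd

/-- The vector field `ρ W`, for a vector field `W` on `TM`. -/
def rhoF (W : VField E M) : PiField E M := fun u ↦ rho u (W u)

/-- The vertical vector field `γ X`. -/
def gammaF (X : PiField E M) : VField E M := fun u ↦ gamma u (X u)

/-- The fundamental `π`-vector field. -/
def eta : PiField E M := fun u ↦ u.snd

end Pullback

section Metric

variable {E : Type*} [NormedAddCommGroup E] [NormedSpace ℝ E]
  {M : Type*} [TopologicalSpace M] [ChartedSpace E M] [IsManifold 𝓘(ℝ, E) ∞ M]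

/-- The Finsler metric of `L`: the second derivative at `u` of the energy `L² / 2` along the
fibre `T_{π u} M`. -/
def metric (L : TangentBundle 𝓘(ℝ, E) M → ℝ) (u : TangentBundle 𝓘(ℝ, E) M) :
    PiSpace E M u →L[ℝ] PiSpace E M u →L[ℝ] ℝ :=
  fderiv ℝ (fderiv ℝ (fun v : E ↦ (1 / 2 : ℝ) * L ⟨u.proj, v⟩ ^ 2)) u.snd

/-- `L` is a Finsler structure on `M`. -/
structure IsFinsler (L : TangentBundle 𝓘(ℝ, E) M → ℝ) : Prop where
  continuous : Continuous L
  smooth : ContMDiffOn 𝓘(ℝ, E).tangent 𝓘(ℝ, ℝ) ∞ L (slit E M)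
  pos : ∀ u ∈ slit E M, 0 < L u
  homogeneous : ∀ (x : M) (v : TangentSpace 𝓘(ℝ, E) x) (t : ℝ), 0 < t →
    L ⟨x, t • v⟩ = t * L ⟨x, v⟩
  posDef : ∀ u ∈ slit E M, ∀ v : PiSpace E M u, v ≠ 0 → 0 < metric L u v v

/-- The form `ℓ = L⁻¹ i_η g`. -/
def ell (L : TangentBundle 𝓘(ℝ, E) M → ℝ) : PiForm E M :=
  fun u ↦ (L u)⁻¹ • metric L u (eta u)

/-- The `π`-vector field `a` that is `g`-dual to `A`, i.e. `g(a, X) = A(X)`. -/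
def dualField (L : TangentBundle 𝓘(ℝ, E) M → ℝ) (A : PiForm E M) : PiField E M :=
  fun u ↦ Function.invFun (fun a ↦ metric L u a) (A u)

end Metric

section Connection

/-- A (smooth, linear) connection on the pullback bundle over the slit tangent bundle.
`toFun Y u w` is `D_w Y`, for `w ∈ T_u(TM)`. -/
structure Connection (E : Type*) [NormedAddCommGroup E] [NormedSpace ℝ E]
    (M : Type*) [TopologicalSpace M] [ChartedSpace E M] [IsManifold 𝓘(ℝ, E) ∞ M] where
  toFun : PiField E M →
    (u : TangentBundle 𝓘(ℝ, E) M) → TangentSpace 𝓘(ℝ, E).tangent u →L[ℝ] PiSpace E M u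
  isCovariantDerivativeOn :
    IsCovariantDerivativeOn (I := 𝓘(ℝ, E).tangent) E toFun (slit E M)
  smooth : ContMDiffCovariantDerivativeOn (I := 𝓘(ℝ, E).tangent) E ∞ toFun (slit E M)

variable {E : Type*} [NormedAddCommGroup E] [NormedSpace ℝ E]
  {M : Type*} [TopologicalSpace M] [ChartedSpace E M] [IsManifold 𝓘(ℝ, E) ∞ M]

namespace Connection

variable (D : Connection E M)

/-- The covariant derivative `D_W Y`. -/
def cov (W : VField E M) (Y : PiField E M) : PiField E M := fun u ↦ D.toFun Y u (W u)

/-- The connection map `K : W ↦ D_W η`. -/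
def connMap (u : TangentBundle 𝓘(ℝ, E) M) :
    TangentSpace 𝓘(ℝ, E).tangent u →L[ℝ] PiSpace E M u :=
  D.toFun eta u

/-- The vertical space at `u`. -/
def vert (u : TangentBundle 𝓘(ℝ, E) M) : Submodule ℝ (TangentSpace 𝓘(ℝ, E).tangent u) :=
  LinearMap.ker (rho u : TangentSpace 𝓘(ℝ, E).tangent u →ₗ[ℝ] PiSpace E M u)

/-- The horizontal space at `u`. -/
def hor (u : TangentBundle 𝓘(ℝ, E) M) : Submodule ℝ (TangentSpace 𝓘(ℝ, E).tangent u) :=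
  LinearMap.ker (D.connMap u : TangentSpace 𝓘(ℝ, E).tangent u →ₗ[ℝ] PiSpace E M u)

/-- `D` is regular: `T_u(TM)` is the direct sum of the vertical and the horizontal space. -/
def Regular : Prop := ∀ u ∈ slit E M, IsCompl (vert u) (D.hor u)

/-- The horizontal lift `β X`, where `β = (ρ restricted to the horizontal space)⁻¹`. -/
def betaF (X : PiField E M) : VField E M :=
  fun u ↦ Function.invFunOn (rho u) (D.hor u : Set (TangentSpace 𝓘(ℝ, E).tangent u)) (X u)

/-- The classical torsion `𝐓(V, W) = D_V ρW - D_W ρV - ρ[V, W]`. -/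
def torsion (V W : VField E M) : PiField E M :=
  D.cov V (rhoF W) - D.cov W (rhoF V)
    - rhoF (VectorField.mlieBracket 𝓘(ℝ, E).tangent V W)

/-- The classical curvature, with the sign convention
`𝐊(V, W) Z = - D_V D_W Z + D_W D_V Z + D_{[V, W]} Z`. -/
def curvature (V W : VField E M) (Z : PiField E M) : PiField E M :=
  - D.cov V (D.cov W Z) + D.cov W (D.cov V Z)
    + D.cov (VectorField.mlieBracket 𝓘(ℝ, E).tangent V W) Z

/-- The (h)h-torsion. -/
def Q (X Y : PiField E M) : PiField E M := D.torsion (D.betaF X) (D.betaF Y)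

/-- The (h)hv-torsion. -/
def T (X Y : PiField E M) : PiField E M := D.torsion (gammaF X) (D.betaF Y)

/-- The h-curvature `R(X, Y) Z`. -/
def R (X Y Z : PiField E M) : PiField E M := D.curvature (D.betaF X) (D.betaF Y) Z

/-- The hv-curvature `P(X, Y) Z`. -/
def P (X Y Z : PiField E M) : PiField E M := D.curvature (D.betaF X) (gammaF Y) Z

/-- The v-curvature `S(X, Y) Z`. -/
def S (X Y Z : PiField E M) : PiField E M := D.curvature (gammaF X) (gammaF Y) Z

/-- The covariant derivative `(D_W g)(Y, Z)` of the Finsler metric of `L`. -/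
def covMetric (L : TangentBundle 𝓘(ℝ, E) M → ℝ) (W : VField E M) (Y Z : PiField E M)
    (u : TangentBundle 𝓘(ℝ, E) M) : ℝ :=
  mvfderiv 𝓘(ℝ, E).tangent (fun p ↦ metric L p (Y p) (Z p)) u (W u)
    - metric L u (D.cov W Y u) (Z u) - metric L u (Y u) (D.cov W Z u)

/-- The covariant derivative `(D_W B)(X, Z)` of a vector-valued `π`-tensor field `B` of rank 2. -/
def covTensor (W : VField E M) (B : PiField E M → PiField E M → PiField E M)
    (X Z : PiField E M) : PiField E M :=
  D.cov W (B X Z) - B (D.cov W X) Z - B X (D.cov W Z)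

/-- `D` is the horizontally recurrent Finsler connection of `L` with h-recurrence form `A`. -/
structure IsHRF (L : TangentBundle 𝓘(ℝ, E) M → ℝ) (A : PiForm E M) : Prop where
  regular : D.Regular
  recurrent : ∀ X Y Z : PiField E M, SmoothPi X → SmoothPi Y → SmoothPi Z → ∀ u ∈ slit E M,
    D.covMetric L (D.betaF X) Y Z u = A u (X u) * metric L u (Y u) (Z u)
  vertical : ∀ X Y Z : PiField E M, SmoothPi X → SmoothPi Y → SmoothPi Z → ∀ u ∈ slit E M,
    D.covMetric L (gammaF X) Y Z u = 0
  hTorsion : ∀ X Y : PiField E M, SmoothPi X → SmoothPi Y → ∀ u ∈ slit E M, D.Q X Y u = 0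
  hvTorsion : ∀ X Y Z : PiField E M, SmoothPi X → SmoothPi Y → SmoothPi Z → ∀ u ∈ slit E M,
    metric L u (D.T X Y u) (Z u) = metric L u (D.T X Z u) (Y u)

/-- `D` is the Cartan connection of `L`: it is regular, metric, without (h)h-torsion, and its
(h)hv-torsion is `g`-symmetric. -/
structure IsCartan (L : TangentBundle 𝓘(ℝ, E) M → ℝ) : Prop where
  regular : D.Regular
  horMetric : ∀ X Y Z : PiField E M, SmoothPi X → SmoothPi Y → SmoothPi Z → ∀ u ∈ slit E M,
    D.covMetric L (D.betaF X) Y Z u = 0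
  vertMetric : ∀ X Y Z : PiField E M, SmoothPi X → SmoothPi Y → SmoothPi Z → ∀ u ∈ slit E M,
    D.covMetric L (gammaF X) Y Z u = 0
  hTorsion : ∀ X Y : PiField E M, SmoothPi X → SmoothPi Y → ∀ u ∈ slit E M, D.Q X Y u = 0
  hvTorsion : ∀ X Y Z : PiField E M, SmoothPi X → SmoothPi Y → SmoothPi Z → ∀ u ∈ slit E M,
    metric L u (D.T X Y u) (Z u) = metric L u (D.T X Z u) (Y u)

/-- The tensor field `N`, built from the (h)hv-torsion `T` of `D` (the Cartan connection). -/
def N (L : TangentBundle 𝓘(ℝ, E) M → ℝ) (A : PiForm E M) (X Y : PiField E M) : PiField E M :=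
  let a := dualField L A
  fun u ↦ (1 / 2 : ℝ) •
    (metric L u (X u) (Y u) • a u - A u (X u) • Y u - A u (Y u) • X u
      - (L u * ell L u (Y u)) • D.T a X u
      + metric L u (D.T a X u) (Y u) • eta u
      + (L u ^ 2) • (D.T (D.T a Y) X u - D.T (D.T X Y) a u))

/-- The `π`-vector field `X_t`, built from the (h)hv-torsion `T` of `D` (the Cartan connection). -/
def shift (L : TangentBundle 𝓘(ℝ, E) M → ℝ) (A : PiForm E M) (X : PiField E M) : PiField E M :=
  let a := dualField L A
  fun u ↦ (1 / 2 : ℝ) •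
    (A u (X u) • eta u + A u (eta u) • X u - metric L u (X u) (eta u) • a u
      + (L u ^ 2) • D.T a X u)

end Connection

end Connection

end Finsler

end

/-! The two connections differ by a tensor, and the curvature identities follow once that tensor is
known.

Vertical directions: (C2) and (C4) alone determine a connection there. The fibre derivative of `g`
is the totally symmetric third derivative of `L² / 2`, so `2 g(T(X, Y), Z)` must equal this cubic
form, and `D_{γX} Y` is the fibre derivative of `Y` plus the Cartan tensor `C(X, Y)`
(`IsVerticallyCartan.T_eq_cartan`, `IsVerticallyCartan.cov_gammaF`). Hence `D` (Cartan) and `D'`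
(HRF) share `T` and agree on vertical vectors.

Horizontal directions: put `n(X) = D_{β'X} η`, so that `β'X = βX + γ n(X)`, and `Δ_X Y = D'_{β'X} Y
- D_{β'X} Y`. Recurrence prescribes the part of `g(Δ_X Y, Z)` symmetric in `Y, Z`; comparing
torsions prescribes the part alternating in `X, Y`, in terms of `n`. Koszul's permutation argument
then gives `Δ` in terms of `n` (`two_mul_metric_difference`). The unknown `n` is removed by
inserting `η`: since `D'_{β'X} η = 0` and `C(η, ·) = 0`, taking `Y = η` expresses `n(X)` through
`n(η)`, and then `X = η` gives `n(η)` explicitly. The result is `n(X) = X_t` (`cov_betaF_eta`) and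
`Δ = N` (`cov_betaF_eq`), so `D'_W Y = D_W Y + N(ρW, Y)` for every `W` (`toFun_eq`).

Curvature: substituting this relation gives one formula for arbitrary `V, W` (`curvature_eq`), in
which the torsion of `D` collects the terms where `N` meets `D_V ρW`, `D_W ρV` and `ρ[V, W]`.
Choosing vertical or `β'`-horizontal fields and expanding `β' = β + γ(·)_t` gives (a), (b), (c). For
(b), `S(X_t, Y)` is expanded by linearity, and its `η`-term vanishes because `C` is homogeneous of
degree `-1` (`IsVerticallyCartan.S_eta`).

Since fields are arbitrary on the zero section, equalities are only available on the open slit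
bundle; hence the various `congr` lemmas. -/

open Bundle Set
open scoped Manifold ContDiff Topology

noncomputable section

namespace Finsler

/-! ### The Lie bracket as a commutator of derivations. -/

section Bracket

variable {E : Type*} [NormedAddCommGroup E] [NormedSpace ℝ E] [CompleteSpace E]
  {H : Type*} [TopologicalSpace H] {I : ModelWithCorners ℝ E H} [I.Boundaryless]
  {M : Type*} [TopologicalSpace M] [ChartedSpace H M] [IsManifold I ∞ M]
  {F : Type*} [NormedAddCommGroup F] [NormedSpace ℝ F]

omit [CompleteSpace E] [IsManifold I ∞ M] in
lemma mvfderiv_eq_fderiv_chart [IsManifold I 1 M] {h : M → F} {x p : M}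
    (hp : p ∈ (extChartAt I x).source)
    (hh : MDifferentiableAt I 𝓘(ℝ, F) h p) (w : TangentSpace I p) :
    mvfderiv I h p w =
      fderiv ℝ (h ∘ (extChartAt I x).symm) (extChartAt I x p)
        (mfderiv I 𝓘(ℝ, E) (extChartAt I x) p w) := by
  set φ := extChartAt I x
  have hsymm : MDifferentiableAt 𝓘(ℝ, E) I φ.symm (φ p) := by
    have := mdifferentiableWithinAt_extChartAt_symm (I := I) (φ.map_source hp)
    rwa [I.range_eq_univ, mdifferentiableWithinAt_univ] at this
  have hφ : MDifferentiableAt I 𝓘(ℝ, E) φ p := mdifferentiableAt_extChartAt (by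
    rwa [← extChartAt_source (I := I)])
  have hcomp : MDifferentiableAt 𝓘(ℝ, E) 𝓘(ℝ, F) (h ∘ φ.symm) (φ p) :=
    MDifferentiableAt.comp_of_eq (φ p) hh hsymm (φ.left_inv hp)
  have heq : h =ᶠ[𝓝 p] (h ∘ φ.symm) ∘ φ := by
    filter_upwards [(isOpen_extChartAt_source (I := I) x).mem_nhds hp] with q hq
    simp [φ.left_inv hq]
  have h1 : mfderiv I 𝓘(ℝ, F) h p = mfderiv I 𝓘(ℝ, F) ((h ∘ φ.symm) ∘ φ) p :=
    heq.mfderiv_eq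
  rw [mfderiv_comp p hcomp hφ, mfderiv_eq_fderiv] at h1
  exact congrArg (fun T : E →L[ℝ] F ↦ T w) h1

variable (I) in
/-- A vector field read in the extended chart at `x`. -/
def chartRep (x : M) (U : (x : M) → TangentSpace I x) : E → E :=
  VectorField.mpullbackWithin 𝓘(ℝ, E) I (extChartAt I x).symm U (range I)

omit [CompleteSpace E] [I.Boundaryless] in
lemma mfderiv_extChartAt_eq_chartRep {x p : M} (U : (x : M) → TangentSpace I x)
    (hp : p ∈ (extChartAt I x).source) :
    mfderiv I 𝓘(ℝ, E) (extChartAt I x) p (U p) = chartRep I x U (extChartAt I x p) := by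
  rw [chartRep, VectorField.mpullbackWithin_apply, (extChartAt I x).left_inv hp,
    ContinuousLinearMap.inverse_eq
      (mfderivWithin_extChartAt_symm_comp_mfderiv_extChartAt' hp)
      (mfderiv_extChartAt_comp_mfderivWithin_extChartAt_symm' hp)]

lemma differentiableAt_chartRep {x : M} {U : (x : M) → TangentSpace I x}
    (hU : MDifferentiableAt I I.tangent (fun p ↦ (⟨p, U p⟩ : TangentBundle I M)) x) :
    DifferentiableAt ℝ (chartRep I x U) (extChartAt I x x) := by
  have h : DifferentiableWithinAt ℝ (chartRep I x U)
      ((extChartAt I x).symm ⁻¹' univ ∩ range I) (extChartAt I x x) :=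
    MDifferentiableWithinAt.differentiableWithinAt_mpullbackWithin_vectorField
      (mdifferentiableWithinAt_univ.mpr hU)
  rwa [preimage_univ, univ_inter, I.range_eq_univ, differentiableWithinAt_univ] at h

omit [CompleteSpace E] in
-- At its own base point the extended chart has identity derivative, so the pullback hidden in the
-- manifold bracket disappears.
lemma mlieBracket_eq_lieBracket_chartRep (V W : (x : M) → TangentSpace I x) (x : M) :
    mfderiv I 𝓘(ℝ, E) (extChartAt I x) x (VectorField.mlieBracket I V W x) =
      VectorField.lieBracket ℝ (chartRep I x V) (chartRep I x W) (extChartAt I x x) := by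
  rw [VectorField.mlieBracket, VectorField.mlieBracketWithin_apply, mfderiv_extChartAt_self]
  change (ContinuousLinearMap.inverse (ContinuousLinearMap.id ℝ E))
    (VectorField.lieBracketWithin ℝ (chartRep I x V) (chartRep I x W)
      ((extChartAt I x).symm ⁻¹' univ ∩ range I) (extChartAt I x x)) = _
  rw [ContinuousLinearMap.inverse_id, preimage_univ, univ_inter, I.range_eq_univ,
    VectorField.lieBracketWithin_univ, ContinuousLinearMap.id_apply]

/-- The Lie bracket acts on functions as the commutator of the directional derivatives. -/
lemma mvfderiv_mlieBracket {f : M → F} {V W : (x : M) → TangentSpace I x} {x : M}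
    (hf : ContMDiffAt I 𝓘(ℝ, F) ∞ f x)
    (hV : MDifferentiableAt I I.tangent (fun p ↦ (⟨p, V p⟩ : TangentBundle I M)) x)
    (hW : MDifferentiableAt I I.tangent (fun p ↦ (⟨p, W p⟩ : TangentBundle I M)) x)
    (hfV : MDifferentiableAt I 𝓘(ℝ, F) (fun p ↦ mvfderiv I f p (V p)) x)
    (hfW : MDifferentiableAt I 𝓘(ℝ, F) (fun p ↦ mvfderiv I f p (W p)) x) :
    mvfderiv I f x (VectorField.mlieBracket I V W x) =
      mvfderiv I (fun p ↦ mvfderiv I f p (W p)) x (V x) -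
        mvfderiv I (fun p ↦ mvfderiv I f p (V p)) x (W x) := by
  set φ := extChartAt I x with hφdef
  set y₀ := φ x with hy₀
  have hxs : x ∈ φ.source := mem_extChartAt_source x
  have hsymm : ContMDiffAt 𝓘(ℝ, E) I ∞ φ.symm y₀ := by
    have := contMDiffWithinAt_extChartAt_symm_range_self (I := I) (n := ∞) x
    rwa [I.range_eq_univ, contMDiffWithinAt_univ] at this
  have hf' : ContDiffAt ℝ ∞ (f ∘ φ.symm) y₀ := by
    rw [← contMDiffAt_iff_contDiffAt]
    exact ContMDiffAt.comp_of_eq hf hsymm (φ.left_inv hxs)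
  -- In the chart, differentiating `f` along `U` and then along `U₂` gives a Hessian term and a term
  -- containing `dU(U₂)`. In the commutator the Hessian terms cancel by symmetry, and the others
  -- form the coordinate bracket.
  have key : ∀ (U U₂ : (x : M) → TangentSpace I x),
      MDifferentiableAt I I.tangent (fun p ↦ (⟨p, U p⟩ : TangentBundle I M)) x →
      MDifferentiableAt I 𝓘(ℝ, F) (fun p ↦ mvfderiv I f p (U p)) x →
      mvfderiv I (fun p ↦ mvfderiv I f p (U p)) x (U₂ x) =
        fderiv ℝ (fderiv ℝ (f ∘ φ.symm)) y₀ (chartRep I x U₂ y₀) (chartRep I x U y₀) +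
        fderiv ℝ (f ∘ φ.symm) y₀ (fderiv ℝ (chartRep I x U) y₀ (chartRep I x U₂ y₀)) := by
    intro U U₂ hU hfU
    rw [mvfderiv_eq_fderiv_chart hxs hfU, mfderiv_extChartAt_eq_chartRep U₂ hxs]
    have hev : (fun p ↦ mvfderiv I f p (U p)) ∘ φ.symm =ᶠ[𝓝 y₀] fun y ↦
        fderiv ℝ (f ∘ φ.symm) y (chartRep I x U y) := by
      have h1 : ∀ᶠ p in 𝓝 x, MDifferentiableAt I 𝓘(ℝ, F) f p := by
        have : ContMDiffAt I 𝓘(ℝ, F) 1 f x := hf.of_le (by exact_mod_cast le_top)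
        filter_upwards [(contMDiffAt_iff_contMDiffAt_nhds (by simp)).1 this] with p hp
        exact hp.mdifferentiableAt one_ne_zero
      have h2 : ∀ᶠ y in 𝓝 y₀, MDifferentiableAt I 𝓘(ℝ, F) f (φ.symm y) := by
        have := hsymm.continuousAt
        rw [ContinuousAt, φ.left_inv hxs] at this
        exact this.eventually h1
      have h3 : ∀ᶠ y in 𝓝 y₀, y ∈ φ.target := extChartAt_target_mem_nhds x
      filter_upwards [h2, h3] with y hy hyt
      simp only [Function.comp_apply]
      rw [mvfderiv_eq_fderiv_chart (φ.map_target hyt) hy,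
        mfderiv_extChartAt_eq_chartRep U (φ.map_target hyt), φ.right_inv hyt]
    rw [hev.fderiv_eq]
    have hdf : DifferentiableAt ℝ (fderiv ℝ (f ∘ φ.symm)) y₀ :=
      (hf'.fderiv_right (m := 1) (one_add_one_eq_two (R := ℕ∞ω) ▸ ENat.LEInfty.out)).differentiableAt one_ne_zero
    rw [fderiv_clm_apply hdf (differentiableAt_chartRep hU)]
    simp [hy₀, hφdef, add_comm]
  rw [key W V hW hfW, key V W hV hfV,
    mvfderiv_eq_fderiv_chart hxs (hf.mdifferentiableAt (by simp)),
    mlieBracket_eq_lieBracket_chartRep, VectorField.lieBracket, map_sub,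
    (hf'.isSymmSndFDerivAt (by simpa using ENat.LEInfty.out)).eq (chartRep I x V y₀) (chartRep I x W y₀)]
  abel

end Bracket

/-! ### The morphisms `ρ` and `γ` in the charts of `TM`. -/

section Lifts

variable {E : Type*} [NormedAddCommGroup E] [NormedSpace ℝ E]
  {M : Type*} [TopologicalSpace M] [ChartedSpace E M] [IsManifold 𝓘(ℝ, E) ∞ M]

lemma trivializationAt_snd_self (x : M) (v : E) :
    (trivializationAt E (TangentSpace 𝓘(ℝ, E)) x (⟨x, v⟩ : TangentBundle 𝓘(ℝ, E) M)).2 = v :=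
  (tangentBundleCore 𝓘(ℝ, E) M).coordChange_self (achart E x) x (mem_chart_source E x) v

/-- The fibre of the pullback bundle is the model space. -/
def piE (u : TangentBundle 𝓘(ℝ, E) M) : PiSpace E M u ≃L[ℝ] E := ContinuousLinearEquiv.refl ℝ E

/-- The tangent space of `TM` is the product of two copies of the model space. -/
def tanE (u : TangentBundle 𝓘(ℝ, E) M) : TangentSpace 𝓘(ℝ, E).tangent u ≃L[ℝ] E × E :=
  ContinuousLinearEquiv.refl ℝ (E × E)

/-- The vector `v`, as an element of the tangent bundle. -/
def mkT (x : M) (v : E) : TangentBundle 𝓘(ℝ, E) M := ⟨x, v⟩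

/-- The vector underlying an element of the tangent bundle. -/
def vec (u : TangentBundle 𝓘(ℝ, E) M) : E := u.snd

omit [IsManifold 𝓘(ℝ, E) ∞ M] in
lemma mkT_vec (u : TangentBundle 𝓘(ℝ, E) M) : mkT u.proj (vec u) = u := rfl

variable (E) in
/-- The identification of `T_x M` with `E` given by the chart at `x₀`. -/
def triv (x₀ x : M) : E →L[ℝ] E :=
  (trivializationAt E (TangentSpace 𝓘(ℝ, E)) x₀).continuousLinearMapAt ℝ x

lemma triv_apply {x₀ x : M} (hx : x ∈ (chartAt E x₀).source) (v : E) :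
    triv E x₀ x v = (trivializationAt E (TangentSpace 𝓘(ℝ, E)) x₀ (mkT x v)).2 :=
  Trivialization.continuousLinearMapAt_apply_of_mem ℝ
    (trivializationAt E (TangentSpace 𝓘(ℝ, E)) x₀) (by simpa using hx) _

lemma triv_injective {x₀ x : M} (hx : x ∈ (chartAt E x₀).source) :
    Function.Injective (triv E x₀ x) := fun v w h ↦ by
  have := (trivializationAt E (TangentSpace 𝓘(ℝ, E)) x₀).symmL_continuousLinearMapAt (R := ℝ)
    (b := x) (by simpa using hx)
  exact (this v).symm.trans ((congrArg _ h).trans (this w))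

lemma triv_self (x : M) (v : E) : triv E x x v = v := by
  rw [triv_apply (mem_chart_source E x), mkT, trivializationAt_snd_self]

lemma contMDiff_fibre (x : M) : ContMDiff 𝓘(ℝ, E) 𝓘(ℝ, E).tangent ∞
    (fun v : E ↦ mkT x v) := by
  intro v
  rw [contMDiffAt_totalSpace]
  refine ⟨contMDiffAt_const, ?_⟩
  have : (fun v : E ↦ (trivializationAt E (TangentSpace 𝓘(ℝ, E)) x
      (mkT x v : TangentBundle 𝓘(ℝ, E) M)).2) = id := by
    ext v
    exact trivializationAt_snd_self x v
  change ContMDiffAt 𝓘(ℝ, E) 𝓘(ℝ, E) ∞ (fun v : E ↦ (trivializationAt E (TangentSpace 𝓘(ℝ, E)) x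
      (mkT x v : TangentBundle 𝓘(ℝ, E) M)).2) v
  rw [this]
  exact contMDiffAt_id

/-- The identification of the fibre at `p` of the pullback bundle with `E` given by the chart
at `u`. -/
def trivP (u p : TangentBundle 𝓘(ℝ, E) M) : PiSpace E M p →L[ℝ] E :=
  (triv E u.proj p.proj).comp (piE p : PiSpace E M p →L[ℝ] E)

/-- The identification of `T_p (TM)` with `E × E` given by the chart at `u`. -/
def trivT (u p : TangentBundle 𝓘(ℝ, E) M) : TangentSpace 𝓘(ℝ, E).tangent p →L[ℝ] E × E :=
  mfderiv 𝓘(ℝ, E).tangent 𝓘(ℝ, E × E) (extChartAt 𝓘(ℝ, E).tangent u) p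

lemma trivP_apply (u p : TangentBundle 𝓘(ℝ, E) M) (x : PiSpace E M p) :
    trivP u p x = triv E u.proj p.proj (piE p x) := rfl

lemma trivP_self (u : TangentBundle 𝓘(ℝ, E) M) (x : PiSpace E M u) : trivP u u x = piE u x :=
  triv_self _ _

lemma trivT_self (u : TangentBundle 𝓘(ℝ, E) M) (w : TangentSpace 𝓘(ℝ, E).tangent u) :
    trivT u u w = tanE u w := by
  rw [trivT, mfderiv_extChartAt_self]
  rfl

lemma eventually_mem_chart (u : TangentBundle 𝓘(ℝ, E) M) :
    ∀ᶠ p : TangentBundle 𝓘(ℝ, E) M in 𝓝 u, p.proj ∈ (chartAt E u.proj).source :=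
  (FiberBundle.continuous_proj E _).continuousAt.eventually
    ((chartAt E u.proj).open_source.mem_nhds (mem_chart_source E u.proj))

/-- Reduces smoothness of a section to smoothness of an `E`-valued function; together with
`contMDiffAt_vField_iff` it lets all later smoothness questions be settled in coordinates. -/
lemma contMDiffAt_pi_iff {Z : PiField E M} {u : TangentBundle 𝓘(ℝ, E) M} :
    ContMDiffAt 𝓘(ℝ, E).tangent (𝓘(ℝ, E).tangent.prod 𝓘(ℝ, E)) ∞
      (fun u ↦ TotalSpace.mk' E u (Z u)) u ↔
    ContMDiffAt 𝓘(ℝ, E).tangent 𝓘(ℝ, E) ∞ (fun p ↦ trivP u p (Z p)) u := by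
  rw [contMDiffAt_section]
  refine Filter.EventuallyEq.contMDiffAt_iff ?_
  filter_upwards [eventually_mem_chart u] with p hp
  exact (triv_apply hp _).symm

lemma mem_chart_tangentBundle_iff (u p : TangentBundle 𝓘(ℝ, E) M) :
    p ∈ (chartAt (ModelProd E E) u).source ↔ p.proj ∈ (chartAt E u.proj).source :=
  TangentBundle.mem_chart_source_iff p u

lemma contMDiffAt_vField_iff {W : VField E M} {u : TangentBundle 𝓘(ℝ, E) M} :
    ContMDiffAt 𝓘(ℝ, E).tangent 𝓘(ℝ, E).tangent.tangent ∞
      (fun p ↦ (⟨p, W p⟩ : TangentBundle 𝓘(ℝ, E).tangent (TangentBundle 𝓘(ℝ, E) M))) u ↔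
    ContMDiffAt 𝓘(ℝ, E).tangent 𝓘(ℝ, E × E) ∞ (fun p ↦ trivT u p (W p)) u := by
  rw [contMDiffAt_section]
  refine Filter.EventuallyEq.contMDiffAt_iff ?_
  filter_upwards [eventually_mem_chart u] with p hp
  rw [← mem_chart_tangentBundle_iff] at hp
  rw [trivT, ← TangentBundle.continuousLinearMapAt_trivializationAt hp]
  exact (Trivialization.continuousLinearMapAt_apply_of_mem ℝ
    (trivializationAt (E × E) (TangentSpace 𝓘(ℝ, E).tangent) u) hp _).symm

lemma extChartAt_tangentBundle_apply (u p : TangentBundle 𝓘(ℝ, E) M) :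
    extChartAt 𝓘(ℝ, E).tangent u p = (extChartAt 𝓘(ℝ, E) u.proj p.proj,
      (trivializationAt E (TangentSpace 𝓘(ℝ, E)) u.proj p).2) := by
  rw [show (extChartAt 𝓘(ℝ, E).tangent u) = _ from FiberBundle.extChartAt u]
  rfl

/-- Restricted to a fibre, the chart of `TM` is constant in its base component and linear in its
fibre component; differentiating this affine map gives the formula. -/
lemma trivT_gamma {u p : TangentBundle 𝓘(ℝ, E) M}
    (hp : p.proj ∈ (chartAt E u.proj).source) (x : PiSpace E M p) :
    trivT u p (gamma p x) = (0, trivP u p x) := by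
  have h1 : MDifferentiableAt 𝓘(ℝ, E).tangent 𝓘(ℝ, E × E) (extChartAt 𝓘(ℝ, E).tangent u) p :=
    mdifferentiableAt_extChartAt ((mem_chart_tangentBundle_iff u p).2 hp)
  have h2 : MDifferentiableAt 𝓘(ℝ, E) 𝓘(ℝ, E).tangent (fun v : E ↦ mkT p.proj v) (vec p) :=
    ((contMDiff_fibre p.proj) (vec p)).mdifferentiableAt (by simp : (∞ : ℕ∞ω) ≠ 0)
  have h3 := mfderiv_comp (I := 𝓘(ℝ, E)) (I' := 𝓘(ℝ, E).tangent) (I'' := 𝓘(ℝ, E × E)) (vec p)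
    (g := extChartAt 𝓘(ℝ, E).tangent u) (f := (fun v : E ↦ mkT p.proj v)) h1 h2
  have h4 : (extChartAt 𝓘(ℝ, E).tangent u ∘ (fun v : E ↦ mkT p.proj v)) =
      fun v : E ↦ (extChartAt 𝓘(ℝ, E) u.proj p.proj, triv E u.proj p.proj v) := by
    ext1 v
    rw [Function.comp_apply, extChartAt_tangentBundle_apply, triv_apply hp]
    rfl
  rw [h4, mfderiv_eq_fderiv, DifferentiableAt.fderiv_prodMk (by fun_prop) (by fun_prop)] at h3
  have h5 := congrArg (fun T : E →L[ℝ] E × E ↦ T (piE p x)) h3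
  refine Eq.trans h5.symm ?_
  simp [trivP_apply]

/-- The first component of the chart of `TM` is the base chart composed with `π`; the two chain
rules for this function are compared. -/
lemma trivT_fst {u p : TangentBundle 𝓘(ℝ, E) M}
    (hp : p.proj ∈ (chartAt E u.proj).source) (w : TangentSpace 𝓘(ℝ, E).tangent p) :
    (trivT u p w).1 = trivP u p (rho p w) := by
  have h1 : MDifferentiableAt 𝓘(ℝ, E).tangent 𝓘(ℝ, E × E) (extChartAt 𝓘(ℝ, E).tangent u) p :=
    mdifferentiableAt_extChartAt ((mem_chart_tangentBundle_iff u p).2 hp)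
  have h2 : MDifferentiableAt 𝓘(ℝ, E) 𝓘(ℝ, E) (extChartAt 𝓘(ℝ, E) u.proj) p.proj :=
    mdifferentiableAt_extChartAt hp
  have h3 : MDifferentiableAt 𝓘(ℝ, E).tangent 𝓘(ℝ, E) (proj E M) p :=
    ((proj E M).contMDiff p).mdifferentiableAt (by simp)
  have h4 := mfderiv_comp (I := 𝓘(ℝ, E).tangent) (I' := 𝓘(ℝ, E × E)) (I'' := 𝓘(ℝ, E)) p
    (g := (Prod.fst : E × E → E)) (f := extChartAt 𝓘(ℝ, E).tangent u)
    (differentiableAt_fst.mdifferentiableAt) h1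
  have h5 := mfderiv_comp (I := 𝓘(ℝ, E).tangent) (I' := 𝓘(ℝ, E)) (I'' := 𝓘(ℝ, E)) p
    (g := extChartAt 𝓘(ℝ, E) u.proj) (f := proj E M) h2 h3
  have h6 : ((Prod.fst : E × E → E) ∘ extChartAt 𝓘(ℝ, E).tangent u) =
      extChartAt 𝓘(ℝ, E) u.proj ∘ proj E M := by
    ext1 q
    rw [Function.comp_apply, extChartAt_tangentBundle_apply]
    rfl
  rw [h6, h5, mfderiv_eq_fderiv, fderiv_fst] at h4
  have h7 := congrArg (fun T : E × E →L[ℝ] E ↦ T (tanE p w)) h4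
  rw [trivP, triv, TangentBundle.continuousLinearMapAt_trivializationAt hp]
  exact h7.symm

lemma gamma_eq (u : TangentBundle 𝓘(ℝ, E) M) (x : PiSpace E M u) :
    tanE u (gamma u x) = (0, piE u x) := by
  rw [← trivT_self, ← trivP_self]
  exact trivT_gamma (mem_chart_source E u.proj) x

lemma rho_eq (u : TangentBundle 𝓘(ℝ, E) M) (w : TangentSpace 𝓘(ℝ, E).tangent u) :
    piE u (rho u w) = (tanE u w).1 := by
  rw [← trivT_self, ← trivP_self]
  exact (trivT_fst (mem_chart_source E u.proj) w).symm

lemma rho_gamma (u : TangentBundle 𝓘(ℝ, E) M) (x : PiSpace E M u) : rho u (gamma u x) = 0 := by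
  apply (piE u).injective
  rw [rho_eq, gamma_eq, map_zero]

lemma rho_surjective (u : TangentBundle 𝓘(ℝ, E) M) : Function.Surjective (rho u) :=
  fun x ↦ ⟨(tanE u).symm (piE u x, 0), (piE u).injective (by simp [rho_eq])⟩

lemma exists_gamma_of_rho_eq_zero {u : TangentBundle 𝓘(ℝ, E) M}
    {w : TangentSpace 𝓘(ℝ, E).tangent u} (h : rho u w = 0) : ∃ x, w = gamma u x := by
  refine ⟨(piE u).symm (tanE u w).2, (tanE u).injective ?_⟩
  rw [gamma_eq]
  refine Prod.ext ?_ (by simp)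
  rw [← rho_eq, h, map_zero]

end Lifts

/-! ### Pointwise smoothness, fibre derivatives, and brackets with vertical fields. -/

section Germs

variable {E : Type*} [NormedAddCommGroup E] [NormedSpace ℝ E]
  {M : Type*} [TopologicalSpace M] [ChartedSpace E M] [IsManifold 𝓘(ℝ, E) ∞ M]
  {F : Type*} [NormedAddCommGroup F] [NormedSpace ℝ F]
  {u : TangentBundle 𝓘(ℝ, E) M}

/-- `X` is smooth at `u`. -/
def PiAt (X : PiField E M) (u : TangentBundle 𝓘(ℝ, E) M) : Prop :=
  ContMDiffAt 𝓘(ℝ, E).tangent (𝓘(ℝ, E).tangent.prod 𝓘(ℝ, E)) ∞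
    (fun p ↦ TotalSpace.mk' E p (X p)) u

/-- The vector field `W` on `TM` is smooth at `u`. -/
def VAt (W : VField E M) (u : TangentBundle 𝓘(ℝ, E) M) : Prop :=
  ContMDiffAt 𝓘(ℝ, E).tangent 𝓘(ℝ, E).tangent.tangent ∞
    (fun p ↦ (⟨p, W p⟩ : TangentBundle 𝓘(ℝ, E).tangent (TangentBundle 𝓘(ℝ, E) M))) u

/-- The function `f` on `TM` is smooth at `u`. -/
def FnAt (f : TangentBundle 𝓘(ℝ, E) M → F) (u : TangentBundle 𝓘(ℝ, E) M) : Prop :=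
  ContMDiffAt 𝓘(ℝ, E).tangent 𝓘(ℝ, F) ∞ f u

lemma piAt_iff {X : PiField E M} : PiAt X u ↔ FnAt (fun p ↦ trivP u p (X p)) u :=
  contMDiffAt_pi_iff

lemma vAt_iff {W : VField E M} : VAt W u ↔ FnAt (fun p ↦ trivT u p (W p)) u :=
  contMDiffAt_vField_iff

lemma PiAt.congr {X Y : PiField E M} (hX : PiAt X u) (h : ∀ᶠ p in 𝓝 u, X p = Y p) : PiAt Y u :=
  ContMDiffAt.congr_of_eventuallyEq hX (h.mono fun p hp ↦ by simp only [hp])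

lemma FnAt.congr {f g : TangentBundle 𝓘(ℝ, E) M → F} (hf : FnAt f u)
    (h : ∀ᶠ p in 𝓝 u, f p = g p) : FnAt g u :=
  ContMDiffAt.congr_of_eventuallyEq hf (h.mono fun _ hp ↦ hp.symm)

lemma PiAt.mdifferentiableAt {X : PiField E M} (hX : PiAt X u) :
    MDifferentiableAt 𝓘(ℝ, E).tangent (𝓘(ℝ, E).tangent.prod 𝓘(ℝ, E))
      (fun p ↦ TotalSpace.mk' E p (X p)) u :=
  ContMDiffAt.mdifferentiableAt hX (by simp)

lemma VAt.mdifferentiableAt {W : VField E M} (hW : VAt W u) :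
    MDifferentiableAt 𝓘(ℝ, E).tangent 𝓘(ℝ, E).tangent.tangent
      (fun p ↦ (⟨p, W p⟩ : TangentBundle 𝓘(ℝ, E).tangent (TangentBundle 𝓘(ℝ, E) M))) u :=
  ContMDiffAt.mdifferentiableAt hW (by simp)

lemma FnAt.mdifferentiableAt {f : TangentBundle 𝓘(ℝ, E) M → F} (hf : FnAt f u) :
    MDifferentiableAt 𝓘(ℝ, E).tangent 𝓘(ℝ, F) f u :=
  ContMDiffAt.mdifferentiableAt hf (by simp)

lemma PiAt.add {X Y : PiField E M} (hX : PiAt X u) (hY : PiAt Y u) : PiAt (X + Y) u :=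
  ContMDiffAt.add_section hX hY

lemma PiAt.sub {X Y : PiField E M} (hX : PiAt X u) (hY : PiAt Y u) : PiAt (X - Y) u :=
  ContMDiffAt.sub_section hX hY

lemma PiAt.smul {f : TangentBundle 𝓘(ℝ, E) M → ℝ} {X : PiField E M} (hf : FnAt f u)
    (hX : PiAt X u) : PiAt (fun p ↦ f p • X p) u :=
  ContMDiffAt.smul_section hf hX

lemma PiAt.const_smul (c : ℝ) {X : PiField E M} (hX : PiAt X u) : PiAt (fun p ↦ c • X p) u :=
  ContMDiffAt.smul_section contMDiffAt_const hX

lemma VAt.add {X Y : VField E M} (hX : VAt X u) (hY : VAt Y u) : VAt (X + Y) u :=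
  ContMDiffAt.add_section hX hY

/-- The coordinate expression of `η` is the fibre component of the identity map of `TM`. -/
lemma piAt_eta : PiAt (eta : PiField E M) u := by
  rw [piAt_iff]
  have h := (contMDiffAt_totalSpace (IM := 𝓘(ℝ, E).tangent) (IB := 𝓘(ℝ, E)) (n := ∞)
    (f := (id : TangentBundle 𝓘(ℝ, E) M → TangentBundle 𝓘(ℝ, E) M)) (x₀ := u)).1 contMDiffAt_id
  refine FnAt.congr (show FnAt _ u from h.2) ?_
  filter_upwards [eventually_mem_chart u] with p hp
  exact (triv_apply hp _).symm

lemma VAt.rhoF {W : VField E M} (hW : VAt W u) : PiAt (rhoF W) u := by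
  rw [vAt_iff] at hW
  rw [piAt_iff]
  refine FnAt.congr (f := fun p ↦ (trivT u p (W p)).1)
    ((ContinuousLinearMap.fst ℝ E E).contMDiff.contMDiffAt.comp u hW) ?_
  filter_upwards [eventually_mem_chart u] with p hp
  exact trivT_fst hp _

lemma PiAt.gammaF {X : PiField E M} (hX : PiAt X u) : VAt (gammaF X) u := by
  rw [piAt_iff] at hX
  rw [vAt_iff]
  refine FnAt.congr (f := fun p ↦ (0, trivP u p (X p))) (contMDiffAt_const.prodMk_space hX) ?_
  filter_upwards [eventually_mem_chart u] with p hp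
  exact (trivT_gamma hp _).symm

lemma FnAt.mvfderiv {f : TangentBundle 𝓘(ℝ, E) M → F} {W : VField E M}
    (hf : FnAt f u) (hW : VAt W u) :
    FnAt (fun p ↦ mvfderiv 𝓘(ℝ, E).tangent f p (W p)) u := by
  rw [vAt_iff] at hW
  set φ := extChartAt 𝓘(ℝ, E).tangent u with hφ
  have hsymm : ContMDiffAt 𝓘(ℝ, E × E) 𝓘(ℝ, E).tangent ∞ φ.symm (φ u) := by
    have := contMDiffWithinAt_extChartAt_symm_range_self (I := 𝓘(ℝ, E).tangent) (n := ∞) u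
    rwa [ModelWithCorners.range_eq_univ, contMDiffWithinAt_univ] at this
  have h0 : ContDiffAt ℝ ∞ (f ∘ φ.symm) (φ u) := by
    rw [← contMDiffAt_iff_contDiffAt]
    exact ContMDiffAt.comp_of_eq hf hsymm (φ.left_inv (mem_extChartAt_source u))
  have h1 : ContDiffAt ℝ ∞ (fderiv ℝ (f ∘ φ.symm)) (φ u) :=
    h0.fderiv_right (m := ∞) (by simp)
  have h2 : FnAt (fun p ↦ fderiv ℝ (f ∘ φ.symm) (φ p)) u :=
    h1.contMDiffAt.comp u contMDiffAt_extChartAt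
  refine FnAt.congr (f := fun p ↦ fderiv ℝ (f ∘ φ.symm) (φ p) (trivT u p (W p)))
    (ContMDiffAt.clm_apply h2 hW) ?_
  have h3 : ∀ᶠ p in 𝓝 u, MDifferentiableAt 𝓘(ℝ, E).tangent 𝓘(ℝ, F) f p := by
    have : ContMDiffAt 𝓘(ℝ, E).tangent 𝓘(ℝ, F) 1 f u := ContMDiffAt.of_le hf (by exact_mod_cast le_top)
    filter_upwards [(contMDiffAt_iff_contMDiffAt_nhds (by simp)).1 this] with p hp
    exact hp.mdifferentiableAt one_ne_zero
  filter_upwards [h3, extChartAt_source_mem_nhds (I := 𝓘(ℝ, E).tangent) u] with p hp hps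
  exact (mvfderiv_eq_fderiv_chart hps hp _).symm

/-- The restriction of a `π`-vector field to a fibre. -/
def fibr (Z : PiField E M) (x : M) : E → E := fun v ↦ piE (mkT x v) (Z (mkT x v))

lemma FnAt.fibre {f : TangentBundle 𝓘(ℝ, E) M → F} (hf : FnAt f u) :
    ContDiffAt ℝ ∞ (fun v ↦ f (mkT u.proj v)) (vec u) := by
  rw [← contMDiffAt_iff_contDiffAt]
  exact ContMDiffAt.comp (vec u) (show ContMDiffAt _ _ _ f (mkT u.proj (vec u)) from hf)
    (contMDiff_fibre u.proj (vec u))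

lemma PiAt.fibr {Z : PiField E M} (hZ : PiAt Z u) : ContDiffAt ℝ ∞ (fibr Z u.proj) (vec u) := by
  have := (piAt_iff.1 hZ).fibre
  refine this.congr_of_eventuallyEq (Filter.Eventually.of_forall fun v ↦ ?_)
  exact (triv_self u.proj _).symm

/-- Since `γ x` is by definition the derivative of the fibre inclusion, this is the chain rule; it
turns every vertical derivative into ordinary calculus on the vector space `E`. -/
lemma mvfderiv_gamma {f : TangentBundle 𝓘(ℝ, E) M → F}
    (hf : MDifferentiableAt 𝓘(ℝ, E).tangent 𝓘(ℝ, F) f u) (x : PiSpace E M u) :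
    mvfderiv 𝓘(ℝ, E).tangent f u (gamma u x) =
      fderiv ℝ (fun v ↦ f (mkT u.proj v)) (vec u) (piE u x) := by
  have h2 : MDifferentiableAt 𝓘(ℝ, E) 𝓘(ℝ, E).tangent (fun v : E ↦ mkT u.proj v) (vec u) :=
    ((contMDiff_fibre u.proj) (vec u)).mdifferentiableAt (by simp : (∞ : ℕ∞ω) ≠ 0)
  have h3 := mfderiv_comp (I := 𝓘(ℝ, E)) (I' := 𝓘(ℝ, E).tangent) (I'' := 𝓘(ℝ, F)) (vec u)
    (g := f) (f := (fun v : E ↦ mkT u.proj v)) hf h2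
  rw [mfderiv_eq_fderiv] at h3
  exact (congrArg (fun T : E →L[ℝ] F ↦ T (piE u x)) h3).symm

/-- The derivative of `Z` along the fibres, in the direction of `X`. -/
def vd (X Z : PiField E M) : PiField E M := fun u ↦
  (piE u).symm (fderiv ℝ (fibr Z u.proj) (vec u) (piE u (X u)))

variable [CompleteSpace E]

lemma VAt.mlieBracket {V W : VField E M} (hV : VAt V u) (hW : VAt W u) :
    VAt (VectorField.mlieBracket 𝓘(ℝ, E).tangent V W) u :=
  haveI : IsManifold 𝓘(ℝ, E).tangent (minSmoothness ℝ 2) (TangentBundle 𝓘(ℝ, E) M) := by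
    rw [minSmoothness_of_isRCLikeNormedField]
    infer_instance
  haveI : IsManifold 𝓘(ℝ, E).tangent ((⊤ : ℕ∞) + 1) (TangentBundle 𝓘(ℝ, E) M) :=
    (inferInstance : IsManifold 𝓘(ℝ, E).tangent ∞ (TangentBundle 𝓘(ℝ, E) M))
  ContMDiffAt.mlieBracket_vectorField (m := ⊤) (n := ⊤) hV hW (by simp)

/-- `mvfderiv_mlieBracket` with the chart itself as the test function: the derivative of the chart
is `trivT`. -/
lemma tanE_mlieBracket {V W : VField E M} (hV : VAt V u) (hW : VAt W u) :
    tanE u (VectorField.mlieBracket 𝓘(ℝ, E).tangent V W u) =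
      mvfderiv 𝓘(ℝ, E).tangent (fun p ↦ trivT u p (W p)) u (V u) -
        mvfderiv 𝓘(ℝ, E).tangent (fun p ↦ trivT u p (V p)) u (W u) := by
  rw [← trivT_self]
  exact mvfderiv_mlieBracket (f := extChartAt 𝓘(ℝ, E).tangent u) contMDiffAt_extChartAt
    hV.mdifferentiableAt hW.mdifferentiableAt (vAt_iff.1 hV).mdifferentiableAt
    (vAt_iff.1 hW).mdifferentiableAt

omit [CompleteSpace E] in
lemma mvfderiv_trivT_gammaF {X : PiField E M} (hX : PiAt X u)
    (w : TangentSpace 𝓘(ℝ, E).tangent u) :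
    mvfderiv 𝓘(ℝ, E).tangent (fun p ↦ trivT u p (gammaF X p)) u w =
      (0, mvfderiv 𝓘(ℝ, E).tangent (fun p ↦ trivP u p (X p)) u w) := by
  have h1 : (fun p ↦ trivT u p (gammaF X p)) =ᶠ[𝓝 u]
      (ContinuousLinearMap.inr ℝ E E) ∘ fun p ↦ trivP u p (X p) := by
    filter_upwards [eventually_mem_chart u] with p hp
    exact trivT_gamma hp _
  have h2 := mfderiv_comp (I := 𝓘(ℝ, E).tangent) (I' := 𝓘(ℝ, E)) (I'' := 𝓘(ℝ, E × E)) u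
    (g := ContinuousLinearMap.inr ℝ E E) (f := fun p ↦ trivP u p (X p))
    (ContinuousLinearMap.inr ℝ E E).differentiableAt.mdifferentiableAt
    (piAt_iff.1 hX).mdifferentiableAt
  rw [← h1.mfderiv_eq, mfderiv_eq_fderiv, ContinuousLinearMap.fderiv] at h2
  exact congrArg (fun T : E × E →L[ℝ] E × E ↦ T (tanE u w)) h2

omit [CompleteSpace E] in
lemma mvfderiv_trivP_gamma {Y : PiField E M} (hY : PiAt Y u) (X : PiField E M) :
    mvfderiv 𝓘(ℝ, E).tangent (fun p ↦ trivP u p (Y p)) u (gamma u (X u)) = piE u (vd X Y u) := by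
  rw [mvfderiv_gamma (piAt_iff.1 hY).mdifferentiableAt]
  have : (fun v ↦ trivP u (mkT u.proj v) (Y (mkT u.proj v))) = fibr Y u.proj := by
    ext1 v
    exact triv_self u.proj _
  rw [this]
  simp [vd]

/-- The bracket of two vertical vector fields. -/
lemma mlieBracket_gammaF {X Y : PiField E M} (hX : PiAt X u) (hY : PiAt Y u) :
    VectorField.mlieBracket 𝓘(ℝ, E).tangent (gammaF X) (gammaF Y) u =
      gamma u (vd X Y u - vd Y X u) := by
  apply (tanE u).injective
  rw [tanE_mlieBracket hX.gammaF hY.gammaF, mvfderiv_trivT_gammaF hX, mvfderiv_trivT_gammaF hY,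
    gammaF, gammaF, mvfderiv_trivP_gamma hX, mvfderiv_trivP_gamma hY, gamma_eq, map_sub]
  simp

/-- The horizontal part of the bracket of a vertical vector field with a vector field. -/
lemma rho_mlieBracket_gammaF {X : PiField E M} {W : VField E M} (hX : PiAt X u) (hW : VAt W u) :
    rho u (VectorField.mlieBracket 𝓘(ℝ, E).tangent (gammaF X) W u) = vd X (rhoF W) u := by
  apply (piE u).injective
  rw [rho_eq, tanE_mlieBracket hX.gammaF hW, mvfderiv_trivT_gammaF hX, Prod.fst_sub, sub_zero,
    ← mvfderiv_trivP_gamma hW.rhoF, gammaF]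
  have h1 : (fun p ↦ trivP u p (rhoF W p)) =ᶠ[𝓝 u]
      (ContinuousLinearMap.fst ℝ E E) ∘ fun p ↦ trivT u p (W p) := by
    filter_upwards [eventually_mem_chart u] with p hp
    exact (trivT_fst hp _).symm
  have h2 := mfderiv_comp (I := 𝓘(ℝ, E).tangent) (I' := 𝓘(ℝ, E × E)) (I'' := 𝓘(ℝ, E)) u
    (g := ContinuousLinearMap.fst ℝ E E) (f := fun p ↦ trivT u p (W p))
    (ContinuousLinearMap.fst ℝ E E).differentiableAt.mdifferentiableAt
    (vAt_iff.1 hW).mdifferentiableAt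
  rw [← h1.mfderiv_eq, mfderiv_eq_fderiv, ContinuousLinearMap.fderiv] at h2
  exact (congrArg (fun T : E × E →L[ℝ] E ↦ T (tanE u (gamma u (X u)))) h2).symm

end Germs

/-! ### Smooth objects over the slit tangent bundle, and extension of vectors. -/

section Slit

variable {E : Type*} [NormedAddCommGroup E] [NormedSpace ℝ E]
  {M : Type*} [TopologicalSpace M] [ChartedSpace E M] [IsManifold 𝓘(ℝ, E) ∞ M]
  {F : Type*} [NormedAddCommGroup F] [NormedSpace ℝ F]
  {u : TangentBundle 𝓘(ℝ, E) M}

variable (E M) in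
lemma isOpen_slit : IsOpen (slit E M) := by
  rw [isOpen_iff_mem_nhds]
  intro u hu
  -- The slit bundle is the nonvanishing locus of `η`, which is detected by a continuous coordinate
  -- expression near `u`.
  have h1 : ContinuousAt (fun p : TangentBundle 𝓘(ℝ, E) M ↦ trivP u p (eta p)) u :=
    ContMDiffAt.continuousAt (piAt_iff.1 piAt_eta)
  have h2 : trivP u u (eta u) ≠ 0 := by
    rw [trivP_self]
    intro h
    exact hu ((piE u).map_eq_zero_iff.1 h)
  filter_upwards [h1.eventually_ne h2] with p hp h
  exact hp (by rw [show eta p = 0 from h, map_zero])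

lemma slit_mem_nhds (hu : u ∈ slit E M) : slit E M ∈ 𝓝 u := (isOpen_slit E M).mem_nhds hu

lemma eventually_of_slit (hu : u ∈ slit E M) {P : TangentBundle 𝓘(ℝ, E) M → Prop}
    (h : ∀ p ∈ slit E M, P p) : ∀ᶠ p in 𝓝 u, P p :=
  Filter.mem_of_superset (slit_mem_nhds hu) h

lemma smoothPi_iff {X : PiField E M} : SmoothPi X ↔ ∀ u ∈ slit E M, PiAt X u :=
  ⟨fun h u hu ↦ (h u hu).contMDiffAt (slit_mem_nhds hu),
    fun h u hu ↦ ContMDiffAt.contMDiffWithinAt (h u hu)⟩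

/-- The vector field `W` is smooth over the slit tangent bundle. -/
def SmoothV (W : VField E M) : Prop := ∀ u ∈ slit E M, VAt W u

/-- The function `f` is smooth over the slit tangent bundle. -/
def SmoothFn (f : TangentBundle 𝓘(ℝ, E) M → F) : Prop := ∀ u ∈ slit E M, FnAt f u

lemma SmoothPi.piAt {X : PiField E M} (hX : SmoothPi X) (hu : u ∈ slit E M) : PiAt X u :=
  smoothPi_iff.1 hX u hu

lemma SmoothPi.congr {X Y : PiField E M} (hX : SmoothPi X) (h : ∀ p ∈ slit E M, X p = Y p) :
    SmoothPi Y :=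
  smoothPi_iff.2 fun _ hu ↦ (hX.piAt hu).congr (eventually_of_slit hu h)

lemma SmoothFn.congr {f g : TangentBundle 𝓘(ℝ, E) M → F} (hf : SmoothFn f)
    (h : ∀ p ∈ slit E M, f p = g p) : SmoothFn g :=
  fun u hu ↦ (hf u hu).congr (eventually_of_slit hu h)

lemma SmoothPi.add {X Y : PiField E M} (hX : SmoothPi X) (hY : SmoothPi Y) : SmoothPi (X + Y) :=
  smoothPi_iff.2 fun _ hu ↦ (hX.piAt hu).add (hY.piAt hu)

lemma SmoothPi.sub {X Y : PiField E M} (hX : SmoothPi X) (hY : SmoothPi Y) : SmoothPi (X - Y) :=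
  smoothPi_iff.2 fun _ hu ↦ (hX.piAt hu).sub (hY.piAt hu)

lemma SmoothPi.smul {f : TangentBundle 𝓘(ℝ, E) M → ℝ} {X : PiField E M} (hf : SmoothFn f)
    (hX : SmoothPi X) : SmoothPi (fun p ↦ f p • X p) :=
  smoothPi_iff.2 fun u hu ↦ PiAt.smul (hf u hu) (hX.piAt hu)

lemma SmoothPi.const_smul (c : ℝ) {X : PiField E M} (hX : SmoothPi X) :
    SmoothPi (fun p ↦ c • X p) :=
  smoothPi_iff.2 fun _ hu ↦ PiAt.const_smul c (hX.piAt hu)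

lemma smoothPi_eta : SmoothPi (eta : PiField E M) := smoothPi_iff.2 fun _ _ ↦ piAt_eta

lemma smoothPi_zero : SmoothPi (0 : PiField E M) :=
  (contMDiff_zeroSection (IB := 𝓘(ℝ, E).tangent) ℝ (PiSpace E M)).contMDiffOn

lemma SmoothV.add {V W : VField E M} (hV : SmoothV V) (hW : SmoothV W) : SmoothV (V + W) :=
  fun u hu ↦ (hV u hu).add (hW u hu)

lemma SmoothPi.gammaF {X : PiField E M} (hX : SmoothPi X) : SmoothV (gammaF X) :=
  fun _ hu ↦ (hX.piAt hu).gammaF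

lemma SmoothV.rhoF {W : VField E M} (hW : SmoothV W) : SmoothPi (rhoF W) :=
  smoothPi_iff.2 fun u hu ↦ (hW u hu).rhoF

lemma SmoothV.mlieBracket [CompleteSpace E] {V W : VField E M} (hV : SmoothV V)
    (hW : SmoothV W) : SmoothV (VectorField.mlieBracket 𝓘(ℝ, E).tangent V W) :=
  fun u hu ↦ (hV u hu).mlieBracket (hW u hu)

lemma SmoothFn.mvfderiv {f : TangentBundle 𝓘(ℝ, E) M → F} {W : VField E M}
    (hf : SmoothFn f) (hW : SmoothV W) :
    SmoothFn (fun p ↦ mvfderiv 𝓘(ℝ, E).tangent f p (W p)) :=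
  fun u hu ↦ (hf u hu).mvfderiv (hW u hu)

section Extension

variable [FiniteDimensional ℝ E] [T2Space M]

/-- Every element of the model space extends to a global `π`-vector field that is constant in a
given trivialization, near a given point. -/
lemma exists_smoothPi_eventually_trivP_eq (u : TangentBundle 𝓘(ℝ, E) M) (e : E) :
    ∃ X : PiField E M, SmoothPi X ∧ ∀ᶠ p in 𝓝 u, trivP u p (X p) = e := by
  let x₀ := u.proj
  let t := trivializationAt E (TangentSpace 𝓘(ℝ, E)) x₀
  let χ : SmoothBumpFunction 𝓘(ℝ, E) x₀ := Classical.arbitrary _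
  let s : (x : M) → TangentSpace 𝓘(ℝ, E) x := fun x ↦ t.symm x e
  have hs : ContMDiffOn 𝓘(ℝ, E) (𝓘(ℝ, E).prod 𝓘(ℝ, E)) ∞ (fun x ↦ TotalSpace.mk' E x (s x))
      t.baseSet := by
    intro x hx
    rw [t.contMDiffWithinAt_section _ hx]
    have : ContMDiffOn 𝓘(ℝ, E) 𝓘(ℝ, E) ∞ (fun _ : M ↦ e) t.baseSet := contMDiffOn_const
    refine (this.congr fun y hy ↦ ?_) x hx
    exact congrArg Prod.snd (Trivialization.apply_mk_symm t hy e)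
  have hχs : ContMDiff 𝓘(ℝ, E) (𝓘(ℝ, E).prod 𝓘(ℝ, E)) ∞
      (fun x ↦ TotalSpace.mk' E x ((⇑χ • s) x)) :=
    ContMDiffOn.smul_section_of_tsupport (V := fun x : M ↦ TangentSpace 𝓘(ℝ, E) x)
      χ.contMDiff.contMDiffOn t.open_baseSet χ.tsupport_subset_chartAt_source hs
  -- A vector field on `M`, constant in the trivialization and cut off by a bump function, is pulled
  -- back along `π`.
  let X : PiField E M := fun p ↦ (piE p).symm ((⇑χ • s) p.proj)
  refine ⟨X, smoothPi_iff.2 fun q _ ↦ ?_, ?_⟩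
  · rw [piAt_iff]
    have h1 := (contMDiffAt_section (IB := 𝓘(ℝ, E)) q.proj).1 (hχs q.proj)
    have h2 := ContMDiffAt.comp q h1 (contMDiff_proj (TangentSpace 𝓘(ℝ, E)) q)
    refine FnAt.congr (show FnAt _ q from h2) ?_
    filter_upwards [eventually_mem_chart q] with p hp
    exact (triv_apply hp _).symm
  · have h3 : ∀ᶠ p : TangentBundle 𝓘(ℝ, E) M in 𝓝 u, χ p.proj = 1 :=
      (FiberBundle.continuous_proj E _).continuousAt.eventually χ.eventuallyEq_one
    filter_upwards [h3, eventually_mem_chart u] with p hp hpc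
    have h4 : (⇑χ • s) p.proj = s p.proj := by
      rw [Pi.smul_apply', hp, one_smul]
    have h5 : (t (TotalSpace.mk' E p.proj (s p.proj))).2 = e := by
      rw [Trivialization.apply_mk_symm t hpc]
    simp only [X, h4]
    exact (triv_apply hpc _).trans h5

/-- Every vector extends to a global `π`-vector field. -/
lemma exists_smoothPi_eq (u : TangentBundle 𝓘(ℝ, E) M) (x : PiSpace E M u) :
    ∃ X : PiField E M, SmoothPi X ∧ X u = x := by
  obtain ⟨X, hX, h⟩ := exists_smoothPi_eventually_trivP_eq u (piE u x)
  refine ⟨X, hX, (piE u).injective ?_⟩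
  rw [← h.self_of_nhds, trivP_self]

end Extension

/-- The solution of a linear system with smooth coefficients is smooth. -/
lemma contMDiffAt_of_clm_apply_eq {N : Type*} {EN : Type*} [NormedAddCommGroup EN]
    [NormedSpace ℝ EN] {HN : Type*} [TopologicalSpace HN] {J : ModelWithCorners ℝ EN HN}
    [TopologicalSpace N] [ChartedSpace HN N]
    {G : Type*} [NormedAddCommGroup G] [NormedSpace ℝ G] [CompleteSpace G]
    {f : N → G →L[ℝ] F} {s : N → G} {c : N → F} {x : N}
    (hf : ContMDiffAt J 𝓘(ℝ, G →L[ℝ] F) ∞ f x) (hc : ContMDiffAt J 𝓘(ℝ, F) ∞ c x)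
    (hs : ∀ᶠ p in 𝓝 x, f p (s p) = c p) (hinv : (f x).IsInvertible) :
    ContMDiffAt J 𝓘(ℝ, G) ∞ s x := by
  obtain ⟨e, he⟩ := hinv
  have h1 : ContDiffAt ℝ ∞ (ContinuousLinearMap.inverse : (G →L[ℝ] F) → _) (f x) := by
    rw [← he]
    exact contDiffAt_map_inverse e
  have h2 : ContMDiffAt J 𝓘(ℝ, G) ∞ (fun p ↦ (f p).inverse (c p)) x :=
    ContMDiffAt.clm_apply (h1.contMDiffAt.comp x hf) hc
  refine h2.congr_of_eventuallyEq ?_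
  have h3 : ∀ᶠ p in 𝓝 x, (f p).IsInvertible := by
    refine hf.continuousAt.eventually (Filter.mem_of_superset ?_ fun L hL ↦ hL)
    rw [← he]
    exact e.nhds
  filter_upwards [hs, h3] with p hp hpi
  exact ((hpi.inverse_apply_eq).2 hp.symm).symm

end Slit

/-! ### Calculus of connections and smoothness of horizontal lifts. -/

namespace Connection

variable {E : Type*} [NormedAddCommGroup E] [NormedSpace ℝ E]
  {M : Type*} [TopologicalSpace M] [ChartedSpace E M] [IsManifold 𝓘(ℝ, E) ∞ M]
  {u : TangentBundle 𝓘(ℝ, E) M} (D : Connection E M)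

section Rules

variable {X Y : PiField E M} {V W : VField E M}

/-- A connection is local and the slit bundle is open, so values on the zero section cannot matter.
-/
lemma toFun_congr (hX : SmoothPi X) (h : ∀ p ∈ slit E M, X p = Y p) (hu : u ∈ slit E M) :
    D.toFun X u = D.toFun Y u :=
  D.isCovariantDerivativeOn.congr_of_eventuallyEq (hX.piAt hu).mdifferentiableAt
    ((hX.congr h).piAt hu).mdifferentiableAt (slit_mem_nhds hu) (eventually_of_slit hu h)

lemma cov_congr (hX : SmoothPi X) (hV : V u = W u) (h : ∀ p ∈ slit E M, X p = Y p)
    (hu : u ∈ slit E M) : D.cov V X u = D.cov W Y u := by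
  rw [cov, cov, D.toFun_congr hX h hu, hV]

lemma cov_add (hX : SmoothPi X) (hY : SmoothPi Y) (hu : u ∈ slit E M) :
    D.cov W (X + Y) u = D.cov W X u + D.cov W Y u := by
  rw [cov, D.isCovariantDerivativeOn.add (hX.piAt hu).mdifferentiableAt
    (hY.piAt hu).mdifferentiableAt hu]
  rfl

lemma cov_smul {f : TangentBundle 𝓘(ℝ, E) M → ℝ} (hf : SmoothFn f) (hX : SmoothPi X)
    (hu : u ∈ slit E M) :
    D.cov W (fun p ↦ f p • X p) u =
      f u • D.cov W X u + mvfderiv 𝓘(ℝ, E).tangent f u (W u) • X u := by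
  have := D.isCovariantDerivativeOn.leibniz (hX.piAt hu).mdifferentiableAt
    (hf u hu).mdifferentiableAt hu
  exact congrArg (fun T ↦ T (W u)) this

lemma cov_zero (hu : u ∈ slit E M) : D.cov W 0 u = 0 := by
  rw [cov, D.isCovariantDerivativeOn.zero hu]
  rfl

lemma cov_eq_zero (h : ∀ p ∈ slit E M, X p = 0) (hu : u ∈ slit E M) : D.cov W X u = 0 := by
  rw [← D.cov_zero (W := W) hu]
  exact (D.cov_congr smoothPi_zero rfl (fun p hp ↦ (h p hp).symm) hu).symm

lemma cov_add_left : D.cov (V + W) X u = D.cov V X u + D.cov W X u :=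
  map_add (D.toFun X u) _ _

lemma cov_smul_left (f : TangentBundle 𝓘(ℝ, E) M → ℝ) :
    D.cov (fun p ↦ f p • W p) X u = f u • D.cov W X u :=
  map_smul (D.toFun X u) _ _

lemma contMDiffAt_toFun (hX : SmoothPi X) (hu : u ∈ slit E M) :
    ContMDiffAt 𝓘(ℝ, E).tangent (𝓘(ℝ, E).tangent.prod 𝓘(ℝ, E × E →L[ℝ] E)) ∞
      (fun p ↦ TotalSpace.mk' (E × E →L[ℝ] E)
        (E := fun p : TangentBundle 𝓘(ℝ, E) M ↦
          TangentSpace 𝓘(ℝ, E).tangent p →L[ℝ] PiSpace E M p) p (D.toFun X p)) u :=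
  (D.smooth.contMDiff (σ := X) hX u hu).contMDiffAt (slit_mem_nhds hu)

lemma piAt_cov (hX : SmoothPi X) (hW : VAt W u) (hu : u ∈ slit E M) : PiAt (D.cov W X) u :=
  ContMDiffAt.clm_bundle_apply (D.contMDiffAt_toFun hX hu) hW

lemma smoothPi_cov (hX : SmoothPi X) (hW : SmoothV W) : SmoothPi (D.cov W X) :=
  smoothPi_iff.2 fun u hu ↦ D.piAt_cov hX (hW u hu) hu

end Rules

section Horizontal

variable {D}

lemma Regular.exists_lift (hD : D.Regular) (hu : u ∈ slit E M) (x : PiSpace E M u) :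
    ∃ w, D.connMap u w = 0 ∧ rho u w = x := by
  obtain ⟨w₀, hw₀⟩ := rho_surjective u x
  have h1 : w₀ ∈ vert u ⊔ D.hor u := by
    rw [(hD u hu).sup_eq_top]
    trivial
  obtain ⟨v, hv, h, hh, rfl⟩ := Submodule.mem_sup.1 h1
  refine ⟨h, hh, ?_⟩
  rw [← hw₀, map_add, show rho u v = 0 from hv, zero_add]

lemma Regular.rho_betaF (hD : D.Regular) (hu : u ∈ slit E M) (X : PiField E M) :
    rho u (D.betaF X u) = X u :=
  Function.invFunOn_eq (f := rho u) (s := (D.hor u : Set (TangentSpace 𝓘(ℝ, E).tangent u)))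
    (hD.exists_lift hu (X u))

lemma Regular.connMap_betaF (hD : D.Regular) (hu : u ∈ slit E M) (X : PiField E M) :
    D.connMap u (D.betaF X u) = 0 :=
  Function.invFunOn_mem (f := rho u) (s := (D.hor u : Set (TangentSpace 𝓘(ℝ, E).tangent u)))
    (hD.exists_lift hu (X u))

lemma Regular.eq_zero (hD : D.Regular) (hu : u ∈ slit E M) {w : TangentSpace 𝓘(ℝ, E).tangent u}
    (h1 : rho u w = 0) (h2 : D.connMap u w = 0) : w = 0 :=
  (Submodule.disjoint_def.1 (hD u hu).disjoint) w h1 h2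

lemma Regular.betaF_eq (hD : D.Regular) (hu : u ∈ slit E M) {X : PiField E M}
    {w : TangentSpace 𝓘(ℝ, E).tangent u} (h1 : rho u w = X u) (h2 : D.connMap u w = 0) :
    D.betaF X u = w := by
  rw [← sub_eq_zero]
  refine hD.eq_zero hu ?_ ?_
  · rw [map_sub, hD.rho_betaF hu, h1, sub_self]
  · rw [map_sub, hD.connMap_betaF hu, h2, sub_self]

/-- The connection map, read in the trivializations at `u`. -/
lemma exists_connMap_coord (D : Connection E M) (hu : u ∈ slit E M) :
    ∃ k : TangentBundle 𝓘(ℝ, E) M → E × E →L[ℝ] E, FnAt k u ∧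
      ∀ᶠ p in 𝓝 u, ∀ w, k p (trivT u p w) = trivP u p (D.connMap p w) := by
  have h := ((contMDiffAt_hom_bundle _).1 (D.contMDiffAt_toFun smoothPi_eta hu)).2
  refine ⟨_, h, ?_⟩
  filter_upwards [eventually_mem_chart u] with p hp w
  have hp1 : p ∈ (trivializationAt (E × E) (TangentSpace 𝓘(ℝ, E).tangent) u).baseSet :=
    (mem_chart_tangentBundle_iff u p).2 hp
  have hp2 : p ∈ (trivializationAt E (PiSpace E M) u).baseSet := hp
  rw [ContinuousLinearMap.inCoordinates_eq hp1 hp2, trivT,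
    ← TangentBundle.continuousLinearMapAt_trivializationAt
      ((mem_chart_tangentBundle_iff u p).2 hp)]
  have h1 : ((trivializationAt (E × E) (TangentSpace 𝓘(ℝ, E).tangent) u).continuousLinearEquivAt ℝ
      p hp1).symm ((trivializationAt (E × E) (TangentSpace 𝓘(ℝ, E).tangent) u).continuousLinearMapAt
        ℝ p w) = w := by
    rw [← Trivialization.coe_continuousLinearEquivAt_eq _ hp1]
    exact ContinuousLinearEquiv.symm_apply_apply _ w
  have h2 : ∀ x : PiSpace E M p, (trivializationAt E (PiSpace E M) u).continuousLinearEquivAt ℝ p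
      hp2 x = trivP u p x := by
    intro x
    rw [trivP_apply, triv_apply hp]
    rfl
  refine Eq.trans ?_ (h2 _)
  exact congrArg (fun v ↦ (trivializationAt E (PiSpace E M) u).continuousLinearEquivAt ℝ p
      hp2 (D.toFun eta p v)) h1

/-- The lift is chosen pointwise by `invFunOn`, so its smoothness has to be earned: it solves the
linear system `(ρ, K) w = (X, 0)`, whose coefficients are smooth and which regularity makes
invertible. -/
lemma Regular.smoothV_betaF [FiniteDimensional ℝ E] (hD : D.Regular) {X : PiField E M}
    (hX : SmoothPi X) : SmoothV (D.betaF X) := by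
  intro u hu
  have : CompleteSpace (E × E) := FiniteDimensional.complete ℝ (E × E)
  obtain ⟨k, hk, hk'⟩ := D.exists_connMap_coord hu
  rw [vAt_iff]
  let B := ContinuousLinearMap.compL ℝ (E × E) E (E × E) (ContinuousLinearMap.inr ℝ E E)
  let f : TangentBundle 𝓘(ℝ, E) M → E × E →L[ℝ] E × E :=
    fun p ↦ (ContinuousLinearMap.inl ℝ E E).comp (ContinuousLinearMap.fst ℝ E E) + B (k p)
  have hfa : ∀ p y, f p y = (y.1, k p y) := fun p y ↦ by simp [f, B]
  have hf : FnAt f u := contMDiffAt_const.add (B.contMDiff.contMDiffAt.comp u hk)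
  have hc : FnAt (fun p ↦ (trivP u p (X p), (0 : E))) u :=
    ContMDiffAt.prodMk_space (piAt_iff.1 (hX.piAt hu)) contMDiffAt_const
  refine contMDiffAt_of_clm_apply_eq (f := f) hf hc ?_ ?_
  · filter_upwards [hk', eventually_mem_chart u, slit_mem_nhds hu] with p hp hpc hps
    rw [hfa, hp, trivT_fst hpc, hD.rho_betaF hps, hD.connMap_betaF hps, map_zero]
  · have hinj : Function.Injective (f u) := by
      rw [injective_iff_map_eq_zero]
      intro y hy
      obtain ⟨w, rfl⟩ := (tanE u).surjective y
      rw [hfa] at hy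
      have hy1 : (tanE u w).1 = 0 := congrArg Prod.fst hy
      have hy2 : k u (tanE u w) = 0 := congrArg Prod.snd hy
      rw [← rho_eq, (piE u).map_eq_zero_iff] at hy1
      rw [← trivT_self, hk'.self_of_nhds, trivP_self, (piE u).map_eq_zero_iff] at hy2
      rw [hD.eq_zero hu hy1 hy2, map_zero]
    exact ⟨(LinearEquiv.ofInjectiveEndo (f u : E × E →ₗ[ℝ] E × E) hinj).toContinuousLinearEquiv,
      ContinuousLinearMap.ext fun y ↦ rfl⟩

end Horizontal

end Connection

section Bracket

open VectorField

variable {E : Type*} [NormedAddCommGroup E] [NormedSpace ℝ E]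
  {M : Type*} [TopologicalSpace M] [ChartedSpace E M] [IsManifold 𝓘(ℝ, E) ∞ M]
  {u : TangentBundle 𝓘(ℝ, E) M} {X X' Y Y' Z : PiField E M} {V V' W W' : VField E M}

lemma vd_congr (hX : X u = X' u) (hu : u ∈ slit E M) (h : ∀ p ∈ slit E M, Y p = Y' p) :
    vd X Y u = vd X' Y' u := by
  have h1 : fibr Y u.proj =ᶠ[𝓝 (vec u)] fibr Y' u.proj := by
    have := (contMDiff_fibre u.proj (vec u)).continuousAt.eventually (eventually_of_slit hu h)
    filter_upwards [this] with v hv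
    exact congrArg (piE _) hv
  rw [vd, vd, h1.fderiv_eq, hX]

omit [IsManifold 𝓘(ℝ, E) ∞ M] in
lemma vd_eta : vd X eta u = X u := by
  have h : fibr (eta : PiField E M) u.proj = id := rfl
  rw [vd, h, fderiv_id]
  exact (piE u).symm_apply_apply _

lemma mlieBracket_congr_slit (hV : ∀ p ∈ slit E M, V p = V' p) (hW : ∀ p ∈ slit E M, W p = W' p)
    (hu : u ∈ slit E M) :
    mlieBracket 𝓘(ℝ, E).tangent V W u = mlieBracket 𝓘(ℝ, E).tangent V' W' u :=
  Filter.EventuallyEq.mlieBracket_vectorField_eq (eventually_of_slit hu hV)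
    (eventually_of_slit hu hW)

end Bracket

/-! ### Torsion and curvature: tensoriality and vertical arguments. -/

namespace Connection

open VectorField

variable {E : Type*} [NormedAddCommGroup E] [NormedSpace ℝ E]
  {M : Type*} [TopologicalSpace M] [ChartedSpace E M] [IsManifold 𝓘(ℝ, E) ∞ M]
  {u : TangentBundle 𝓘(ℝ, E) M} (D : Connection E M)
  {X X' Y Y' Z : PiField E M} {V V' W W' : VField E M}

lemma torsion_swap : D.torsion V W u = -D.torsion W V u := by
  simp only [torsion, Pi.sub_apply, rhoF, mlieBracket_swap_apply (V := V), map_neg]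
  abel

lemma torsion_congr (hV : SmoothV V) (hW : SmoothV W) (h : ∀ p ∈ slit E M, V p = V' p)
    (h' : ∀ p ∈ slit E M, W p = W' p) (hu : u ∈ slit E M) :
    D.torsion V W u = D.torsion V' W' u := by
  simp only [torsion, Pi.sub_apply, rhoF, mlieBracket_congr_slit h h' hu]
  congr 2
  · exact D.cov_congr hW.rhoF (h u hu) (fun p hp ↦ congrArg (rho p) (h' p hp)) hu
  · exact D.cov_congr hV.rhoF (h' u hu) (fun p hp ↦ congrArg (rho p) (h p hp)) hu

lemma curvature_congr (hZ : SmoothPi Z) (hV : SmoothV V) (hW : SmoothV W)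
    (h : ∀ p ∈ slit E M, V p = V' p)
    (h' : ∀ p ∈ slit E M, W p = W' p) (hu : u ∈ slit E M) :
    D.curvature V W Z u = D.curvature V' W' Z u := by
  simp only [curvature, Pi.add_apply, Pi.neg_apply]
  congr 1
  · congr 1
    · exact congrArg _ (D.cov_congr (D.smoothPi_cov hZ hW) (h u hu)
        (fun p hp ↦ D.cov_congr hZ (h' p hp) (fun _ _ ↦ rfl) hp) hu)
    · exact D.cov_congr (D.smoothPi_cov hZ hV) (h' u hu)
        (fun p hp ↦ D.cov_congr hZ (h p hp) (fun _ _ ↦ rfl) hp) hu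
  · exact D.cov_congr hZ (mlieBracket_congr_slit h h' hu) (fun _ _ ↦ rfl) hu

lemma curvature_swap : D.curvature V W Z u = -D.curvature W V Z u := by
  have h : D.cov (mlieBracket 𝓘(ℝ, E).tangent V W) Z u =
      -D.cov (mlieBracket 𝓘(ℝ, E).tangent W V) Z u := by
    rw [mlieBracket_swap]
    exact map_neg (D.toFun Z u) _
  simp only [curvature, Pi.add_apply, Pi.neg_apply, h]
  abel

section Complete

variable [CompleteSpace E]

lemma smoothPi_torsion (hV : SmoothV V) (hW : SmoothV W) : SmoothPi (D.torsion V W) :=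
  ((D.smoothPi_cov hW.rhoF hV).sub (D.smoothPi_cov hV.rhoF hW)).sub (hV.mlieBracket hW).rhoF

lemma torsion_add_left (hV : SmoothV V) (hV' : SmoothV V') (hu : u ∈ slit E M) :
    D.torsion (V + V') W u = D.torsion V W u + D.torsion V' W u := by
  have h : rhoF (V + V') = rhoF V + rhoF V' := funext fun p ↦ map_add (rho p) _ _
  simp only [torsion, Pi.sub_apply, h, D.cov_add hV.rhoF hV'.rhoF hu, D.cov_add_left]
  simp only [rhoF, mlieBracket_add_left (hV u hu).mdifferentiableAt (hV' u hu).mdifferentiableAt,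
    map_add]
  abel

/-- `ρ γ = 0` removes one covariant derivative, and the horizontal part of the bracket is a fibre
derivative. -/
lemma torsion_gammaF (hX : SmoothPi X) (hW : SmoothV W) (hu : u ∈ slit E M) :
    D.torsion (gammaF X) W u = D.cov (gammaF X) (rhoF W) u - vd X (rhoF W) u := by
  have h : ∀ p ∈ slit E M, rhoF (gammaF X) p = 0 := fun p _ ↦ rho_gamma p (X p)
  simp only [torsion, Pi.sub_apply]
  rw [D.cov_eq_zero h hu, sub_zero]
  exact congrArg _ (rho_mlieBracket_gammaF (hX.piAt hu) (hW u hu))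

lemma curvature_add_left (hZ : SmoothPi Z) (hV : SmoothV V) (hV' : SmoothV V')
    (hu : u ∈ slit E M) :
    D.curvature (V + V') W Z u = D.curvature V W Z u + D.curvature V' W Z u := by
  have h : D.cov (V + V') Z = D.cov V Z + D.cov V' Z := funext fun p ↦ map_add (D.toFun Z p) _ _
  have h' : D.cov (mlieBracket 𝓘(ℝ, E).tangent (V + V') W) Z u =
      D.cov (mlieBracket 𝓘(ℝ, E).tangent V W) Z u +
        D.cov (mlieBracket 𝓘(ℝ, E).tangent V' W) Z u := by
    rw [cov, mlieBracket_add_left (hV u hu).mdifferentiableAt (hV' u hu).mdifferentiableAt]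
    exact map_add (D.toFun Z u) _ _
  simp only [curvature, Pi.add_apply, Pi.neg_apply, h, h', D.cov_add_left,
    D.cov_add (D.smoothPi_cov hZ hV) (D.smoothPi_cov hZ hV') hu]
  abel

lemma curvature_add_right (hZ : SmoothPi Z) (hW : SmoothV W) (hW' : SmoothV W')
    (hu : u ∈ slit E M) :
    D.curvature V (W + W') Z u = D.curvature V W Z u + D.curvature V W' Z u := by
  rw [D.curvature_swap, D.curvature_add_left hZ hW hW' hu, D.curvature_swap (V := V) (W := W),
    D.curvature_swap (V := V) (W := W')]
  abel

/-- The derivative of `f` produced by the Leibniz rule in `D_W D_{fV} Z` cancels the one produced by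
`[fV, W]`. -/
lemma curvature_smul_left {f : TangentBundle 𝓘(ℝ, E) M → ℝ} (hf : SmoothFn f) (hZ : SmoothPi Z)
    (hV : SmoothV V) (hu : u ∈ slit E M) :
    D.curvature (fun p ↦ f p • V p) W Z u = f u • D.curvature V W Z u := by
  have h : D.cov (fun p ↦ f p • V p) Z = fun p ↦ f p • D.cov V Z p :=
    funext fun p ↦ map_smul (D.toFun Z p) _ _
  have h' : D.cov (mlieBracket 𝓘(ℝ, E).tangent (fun p ↦ f p • V p) W) Z u =
      f u • D.cov (mlieBracket 𝓘(ℝ, E).tangent V W) Z u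
        - mvfderiv 𝓘(ℝ, E).tangent f u (W u) • D.cov V Z u := by
    have h1 := mlieBracket_smul_left (W := W) (hf u hu).mdifferentiableAt
      (hV u hu).mdifferentiableAt
    refine (congrArg (D.toFun Z u) h1).trans ?_
    rw [map_add, map_smul, map_smul, neg_smul, add_comm, ← sub_eq_add_neg]
    rfl
  simp only [curvature, Pi.add_apply, Pi.neg_apply, h, h', D.cov_smul_left,
    D.cov_smul hf (D.smoothPi_cov hZ hV) hu, smul_add, smul_neg]
  abel

end Complete

variable [FiniteDimensional ℝ E] {D}

lemma Regular.T_eq (hD : D.Regular) (hX : SmoothPi X) (hY : SmoothPi Y) (hu : u ∈ slit E M) :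
    D.T X Y u = D.cov (gammaF X) Y u - vd X Y u := by
  have := FiniteDimensional.complete ℝ E
  have h : ∀ p ∈ slit E M, Y p = rhoF (D.betaF Y) p := fun p hp ↦ (hD.rho_betaF hp Y).symm
  rw [T, D.torsion_gammaF hX (hD.smoothV_betaF hY) hu,
    D.cov_congr (hY.congr h) rfl (fun p hp ↦ (h p hp).symm) hu,
    vd_congr rfl hu (fun p hp ↦ (h p hp).symm)]

lemma Regular.smoothPi_T (hD : D.Regular) (hX : SmoothPi X) (hY : SmoothPi Y) :
    SmoothPi (D.T X Y) :=
  have := FiniteDimensional.complete ℝ E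
  D.smoothPi_torsion hX.gammaF (hD.smoothV_betaF hY)

/-- The torsion of a vertical and an arbitrary vector field. -/
lemma Regular.torsion_gammaF_eq (hD : D.Regular) (hX : SmoothPi X) (hW : SmoothV W)
    (hu : u ∈ slit E M) : D.torsion (gammaF X) W u = D.T X (rhoF W) u := by
  have := FiniteDimensional.complete ℝ E
  rw [D.torsion_gammaF hX hW hu, hD.T_eq hX hW.rhoF hu]

/-- The torsion in terms of horizontal and vertical parts. -/
lemma torsion_horizontal_add_vertical (hD : D.Regular) (hX : SmoothPi X) (hY : SmoothPi Y)
    (hX' : SmoothPi X') (hY' : SmoothPi Y')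
    (hV : ∀ p ∈ slit E M, V p = (D.betaF X + gammaF X') p)
    (hW : ∀ p ∈ slit E M, W p = (D.betaF Y + gammaF Y') p) (hu : u ∈ slit E M) :
    D.torsion V W u = D.Q X Y u + D.T X' Y u - D.T Y' X u := by
  have := FiniteDimensional.complete ℝ E
  have hbX := hD.smoothV_betaF hX
  have hbY := hD.smoothV_betaF hY
  -- Against a vertical field the torsion sees only `ρ W`, so a vertical summand of `W` contributes
  -- nothing; in particular two vertical fields have zero torsion.
  have key : ∀ {X' Y : PiField E M}, SmoothPi X' → SmoothPi Y → ∀ W : VField E M, SmoothV W →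
      (∀ p ∈ slit E M, rho p (W p) = Y p) → D.torsion (gammaF X') W u = D.T X' Y u := by
    intro X' Y hX' hY W hWs hW
    rw [hD.torsion_gammaF_eq hX' hWs hu, hD.T_eq hX' hWs.rhoF hu, hD.T_eq hX' hY hu,
      D.cov_congr hWs.rhoF rfl hW hu, vd_congr (Y := rhoF W) rfl hu hW]
  have hWs : SmoothV (D.betaF Y + gammaF Y') := hbY.add hY'.gammaF
  rw [← D.torsion_congr (hbX.add hX'.gammaF) hWs (fun p hp ↦ (hV p hp).symm)
      (fun p hp ↦ (hW p hp).symm) hu, D.torsion_add_left hbX hX'.gammaF hu,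
    key hX' hY _ hWs, D.torsion_swap, D.torsion_add_left hbY hY'.gammaF hu,
    key hY' hX _ hbX (fun p hp ↦ hD.rho_betaF hp X), D.torsion_swap, Q]
  · abel
  · intro p hp
    rw [Pi.add_apply, map_add, hD.rho_betaF hp, gammaF, rho_gamma, add_zero]

end Connection

/-! ### Positively homogeneous functions. -/

section Homogeneous

variable {E : Type*} [NormedAddCommGroup E] [NormedSpace ℝ E]
  {F : Type*} [NormedAddCommGroup F] [NormedSpace ℝ F] {f : E → F} {k : ℤ} {v : E}

/-- Euler's relation for positively homogeneous functions. -/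
lemma fderiv_apply_self_of_homogeneous (hf : DifferentiableAt ℝ f v)
    (h : ∀ t : ℝ, 0 < t → f (t • v) = t ^ k • f v) : fderiv ℝ f v v = (k : ℝ) • f v := by
  have h1 : HasDerivAt (fun t : ℝ ↦ t • v) v 1 := by
    simpa using (hasDerivAt_id (1 : ℝ)).smul_const v
  have h2 : HasDerivAt (fun t : ℝ ↦ f (t • v)) (fderiv ℝ f v v) 1 := by
    refine HasFDerivAt.comp_hasDerivAt (l := f) (f := fun t : ℝ ↦ t • v) 1 ?_ h1
    rw [one_smul]
    exact hf.hasFDerivAt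
  have h3 : HasDerivAt (fun t : ℝ ↦ t ^ k • f v) ((k : ℝ) • f v) 1 := by
    simpa using (hasDerivAt_zpow k (1 : ℝ) (Or.inl one_ne_zero)).smul_const (f v)
  refine h2.unique (h3.congr_of_eventuallyEq ?_)
  filter_upwards [lt_mem_nhds (zero_lt_one' ℝ)] with t ht using h t ht

/-- Each derivative lowers the degree by one. The exponent is an integer because the third
derivative of the energy has degree `-1`. -/
lemma fderiv_homogeneous (h : ∀ (w : E) (t : ℝ), 0 < t → f (t • w) = t ^ k • f w)
    (w : E) (t : ℝ) (ht : 0 < t) : fderiv ℝ f (t • w) = t ^ (k - 1) • fderiv ℝ f w := by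
  have h1 : (f <| t • ·) = t ^ k • f := funext fun w ↦ h w t ht
  have h2 := fderiv_comp_smul (𝕜 := ℝ) (f := f) (x := w) t
  rw [h1, fderiv_const_smul_field, Pi.smul_apply] at h2
  rw [zpow_sub_one₀ ht.ne', mul_comm, mul_smul, h2, inv_smul_smul₀ ht.ne']

end Homogeneous

/-! ### The Finsler metric, its fibre derivative, and Euler relations. -/

section Metric

variable {E : Type*} [NormedAddCommGroup E] [NormedSpace ℝ E]
  {M : Type*} [TopologicalSpace M] [ChartedSpace E M] [IsManifold 𝓘(ℝ, E) ∞ M]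
  {L : TangentBundle 𝓘(ℝ, E) M → ℝ} {u : TangentBundle 𝓘(ℝ, E) M}

/-- The energy `L² / 2` on the fibre over `x`. -/
def energy (L : TangentBundle 𝓘(ℝ, E) M → ℝ) (x : M) : E → ℝ :=
  fun v ↦ (1 / 2 : ℝ) * L (mkT x v) ^ 2

/-- The third derivative of the energy along the fibres. -/
def cubic (L : TangentBundle 𝓘(ℝ, E) M → ℝ) (u : TangentBundle 𝓘(ℝ, E) M) :
    PiSpace E M u →L[ℝ] PiSpace E M u →L[ℝ] PiSpace E M u →L[ℝ] ℝ :=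
  fderiv ℝ (fderiv ℝ (fderiv ℝ (energy L u.proj))) (vec u)

omit [IsManifold 𝓘(ℝ, E) ∞ M] in
lemma metric_eq (x y : PiSpace E M u) : metric L u x y =
    fderiv ℝ (fderiv ℝ (energy L u.proj)) (vec u) (piE u x) (piE u y) := rfl

omit [IsManifold 𝓘(ℝ, E) ∞ M] in
lemma cubic_eq (x y z : PiSpace E M u) : cubic L u x y z =
    fderiv ℝ (fderiv ℝ (fderiv ℝ (energy L u.proj))) (vec u) (piE u x) (piE u y) (piE u z) := rfl

variable (hL : IsFinsler L)

include hL

set_option maxSynthPendingDepth 3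

lemma IsFinsler.smoothFn : SmoothFn L :=
  fun u hu ↦ (hL.smooth u hu).contMDiffAt (slit_mem_nhds hu)

lemma IsFinsler.contDiffAt_energy (hu : u ∈ slit E M) :
    ContDiffAt ℝ ∞ (energy L u.proj) (vec u) :=
  contDiffAt_const.mul ((hL.smoothFn u hu).fibre.pow 2)

lemma IsFinsler.contDiffAt_fderiv_energy (hu : u ∈ slit E M) :
    ContDiffAt ℝ ∞ (fderiv ℝ (energy L u.proj)) (vec u) :=
  (hL.contDiffAt_energy hu).fderiv_right (by simp)

lemma IsFinsler.contDiffAt_fderiv_fderiv_energy (hu : u ∈ slit E M) :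
    ContDiffAt ℝ ∞ (fderiv ℝ (fderiv ℝ (energy L u.proj))) (vec u) :=
  (hL.contDiffAt_fderiv_energy hu).fderiv_right (by simp)

lemma IsFinsler.contDiffAt_cubic (hu : u ∈ slit E M) :
    ContDiffAt ℝ ∞ (fderiv ℝ (fderiv ℝ (fderiv ℝ (energy L u.proj)))) (vec u) :=
  (hL.contDiffAt_fderiv_fderiv_energy hu).fderiv_right (by simp)

omit hL in
lemma minSmoothness_two_le : minSmoothness ℝ 2 ≤ ∞ := by
  rw [minSmoothness_of_isRCLikeNormedField]
  exact ENat.LEInfty.out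

lemma IsFinsler.metric_symm (hu : u ∈ slit E M) (x y : PiSpace E M u) :
    metric L u x y = metric L u y x :=
  (hL.contDiffAt_energy hu).isSymmSndFDerivAt minSmoothness_two_le _ _

lemma IsFinsler.cubic_symm (hu : u ∈ slit E M) (x y z : PiSpace E M u) :
    cubic L u x y z = cubic L u y x z :=
  congrArg (fun l ↦ l (piE u z))
    ((hL.contDiffAt_fderiv_energy hu).isSymmSndFDerivAt minSmoothness_two_le (piE u x) (piE u y))

/-- Symmetry in the last two slots comes from differentiating the symmetry of `g`, which holds at
all nearby nonzero vectors; with `cubic_symm` the cubic form is totally symmetric. -/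
lemma IsFinsler.cubic_symm' (hu : u ∈ slit E M) (x y z : PiSpace E M u) :
    cubic L u x y z = cubic L u x z y := by
  set H := fderiv ℝ (fderiv ℝ (energy L u.proj)) with hH
  have h1 : DifferentiableAt ℝ H (vec u) :=
    (hL.contDiffAt_fderiv_fderiv_energy hu).differentiableAt (by simp)
  have h2 : ∀ a b : E, HasFDerivAt (fun v ↦ H v a b)
      ((fderiv ℝ H (vec u)).flip a |>.flip b) (vec u) := by
    intro a b
    have := (h1.hasFDerivAt.clm_apply (hasFDerivAt_const a _)).clm_apply (hasFDerivAt_const b _)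
    refine this.congr_fderiv ?_
    ext
    simp
  have h3 : (fun v ↦ H v (piE u y) (piE u z)) =ᶠ[𝓝 (vec u)]
      fun v ↦ H v (piE u z) (piE u y) := by
    have := (contMDiff_fibre u.proj (vec u)).continuousAt.eventually
      (eventually_of_slit hu fun p hp ↦ hp)
    filter_upwards [this] with v hv
    exact hL.metric_symm hv _ _
  have h4 := (h2 (piE u y) (piE u z)).unique ((h2 (piE u z) (piE u y)).congr_of_eventuallyEq h3)
  exact congrArg (fun l ↦ l (piE u x)) h4

lemma IsFinsler.energy_homogeneous (x : M) (w : E) (t : ℝ) (ht : 0 < t) :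
    energy L x (t • w) = t ^ (2 : ℤ) • energy L x w := by
  have h : L (mkT x (t • w)) = t * L (mkT x w) := hL.homogeneous x w t ht
  simp only [energy, h, smul_eq_mul]
  norm_cast
  ring

lemma IsFinsler.fderiv_energy_homogeneous (x : M) (w : E) (t : ℝ) (ht : 0 < t) :
    fderiv ℝ (energy L x) (t • w) = t ^ (1 : ℤ) • fderiv ℝ (energy L x) w :=
  fderiv_homogeneous (k := 2) (hL.energy_homogeneous x) w t ht

lemma IsFinsler.fderiv_fderiv_energy_homogeneous (x : M) (w : E) (t : ℝ) (ht : 0 < t) :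
    fderiv ℝ (fderiv ℝ (energy L x)) (t • w) =
      t ^ (0 : ℤ) • fderiv ℝ (fderiv ℝ (energy L x)) w :=
  fderiv_homogeneous (k := 1) (hL.fderiv_energy_homogeneous x) w t ht

lemma IsFinsler.fderiv_fderiv_fderiv_energy_homogeneous (x : M) (w : E) (t : ℝ) (ht : 0 < t) :
    fderiv ℝ (fderiv ℝ (fderiv ℝ (energy L x))) (t • w) =
      t ^ (-1 : ℤ) • fderiv ℝ (fderiv ℝ (fderiv ℝ (energy L x))) w :=
  fderiv_homogeneous (k := 0) (hL.fderiv_fderiv_energy_homogeneous x) w t ht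

/-- Euler's relation for `g`, which is homogeneous of degree zero. -/
lemma IsFinsler.cubic_eta (hu : u ∈ slit E M) : cubic L u (eta u) = 0 := by
  have h := fderiv_apply_self_of_homogeneous
    ((hL.contDiffAt_fderiv_fderiv_energy hu).differentiableAt (by simp))
    (hL.fderiv_fderiv_energy_homogeneous u.proj (vec u))
  rw [Int.cast_zero, zero_smul] at h
  exact h

/-- The third derivative of the energy is homogeneous of degree `-1`. -/
lemma IsFinsler.fderiv_cubic_eta (hu : u ∈ slit E M) :
    fderiv ℝ (fderiv ℝ (fderiv ℝ (fderiv ℝ (energy L u.proj)))) (vec u) (vec u) =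
      -fderiv ℝ (fderiv ℝ (fderiv ℝ (energy L u.proj))) (vec u) := by
  have h := fderiv_apply_self_of_homogeneous
    ((hL.contDiffAt_cubic hu).differentiableAt (by simp))
    (hL.fderiv_fderiv_fderiv_energy_homogeneous u.proj (vec u))
  rw [h]
  simp

/-- Euler's relation twice: `g(η, ·)` is the differential of the energy (degree one), and its value
on `η` is twice the energy (degree two). -/
lemma IsFinsler.metric_eta_eta (hu : u ∈ slit E M) : metric L u (eta u) (eta u) = L u ^ 2 := by
  have h1 := fderiv_apply_self_of_homogeneous
    ((hL.contDiffAt_fderiv_energy hu).differentiableAt (by simp))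
    (hL.fderiv_energy_homogeneous u.proj (vec u))
  have h2 := fderiv_apply_self_of_homogeneous
    ((hL.contDiffAt_energy hu).differentiableAt (by simp)) (hL.energy_homogeneous u.proj (vec u))
  have h3 : metric L u (eta u) (eta u) = fderiv ℝ (energy L u.proj) (vec u) (vec u) := by
    refine (congrArg (fun l ↦ l (vec u)) h1).trans ?_
    simp
  rw [h3, h2, energy, mkT_vec]
  simp

lemma IsFinsler.ell_eq (hu : u ∈ slit E M) (x : PiSpace E M u) :
    L u * ell L u x = metric L u (eta u) x := by
  have h : ell L u x = (L u)⁻¹ * metric L u (eta u) x := rfl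
  rw [h, mul_inv_cancel_left₀ (hL.pos u hu).ne']

/-- Positive definiteness makes `g` nondegenerate. Many tensor identities below are proved by
pairing with a test vector. -/
lemma IsFinsler.eq_of_metric (hu : u ∈ slit E M) {x y : PiSpace E M u}
    (h : ∀ z, metric L u x z = metric L u y z) : x = y := by
  by_contra hne
  have h1 := hL.posDef u hu (x - y) (sub_ne_zero.2 hne)
  have h2 : metric L u (x - y) (x - y) = metric L u x (x - y) - metric L u y (x - y) :=
    congrArg (fun l ↦ l (x - y)) (map_sub (metric L u) x y)
  rw [h2, h, sub_self] at h1
  exact h1.false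

lemma IsFinsler.metric_surjective [FiniteDimensional ℝ E] (hu : u ∈ slit E M)
    (φ : PiSpace E M u →L[ℝ] ℝ) : ∃ a, metric L u a = φ := by
  let T : E →ₗ[ℝ] Module.Dual ℝ E := (LinearMap.toContinuousLinearMap (𝕜 := ℝ) (E := E)
    (F' := ℝ)).symm.toLinearMap ∘ₗ
      (fderiv ℝ (fderiv ℝ (energy L u.proj)) (vec u) : E →ₗ[ℝ] E →L[ℝ] ℝ)
  have hT : Function.Injective T := fun x y h ↦
    hL.eq_of_metric hu (x := (piE u).symm x) (y := (piE u).symm y)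
      fun z ↦ congrArg (fun l ↦ l (piE u z)) h
  obtain ⟨x, hx⟩ := (LinearMap.injective_iff_surjective_of_finrank_eq_finrank
    (Subspace.dual_finrank_eq (K := ℝ) (V := E)).symm).1 hT
      (((φ : PiSpace E M u →ₗ[ℝ] ℝ) ∘ₗ ((piE u).symm : E →ₗ[ℝ] PiSpace E M u)))
  refine ⟨(piE u).symm x, ContinuousLinearMap.ext fun z ↦ ?_⟩
  exact congrArg (fun l ↦ l (piE u z)) hx

lemma IsFinsler.metric_dualField [FiniteDimensional ℝ E] (hu : u ∈ slit E M) (A : PiForm E M)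
    (x : PiSpace E M u) : metric L u (dualField L A u) x = A u x :=
  congrArg (fun l ↦ l x) (Function.invFun_eq (hL.metric_surjective hu (A u)))

end Metric

section Metric

variable {E : Type*} [NormedAddCommGroup E] [NormedSpace ℝ E]
  {M : Type*} [TopologicalSpace M] [ChartedSpace E M] [IsManifold 𝓘(ℝ, E) ∞ M]
  {L : TangentBundle 𝓘(ℝ, E) M → ℝ} {u : TangentBundle 𝓘(ℝ, E) M}
  {X Y Z : PiField E M}

lemma hasFDerivAt_fibr (hY : PiAt Y u) :
    HasFDerivAt (fibr Y u.proj) (fderiv ℝ (fibr Y u.proj) (vec u)) (vec u) :=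
  (hY.fibr.differentiableAt (by simp)).hasFDerivAt

variable (hL : IsFinsler L)

include hL

lemma IsFinsler.mvfderiv_metric_gamma (hY : SmoothPi Y) (hZ : SmoothPi Z) (hu : u ∈ slit E M)
    (hg : FnAt (fun p ↦ metric L p (Y p) (Z p)) u) :
    mvfderiv 𝓘(ℝ, E).tangent (fun p ↦ metric L p (Y p) (Z p)) u (gammaF X u) =
      cubic L u (X u) (Y u) (Z u) + metric L u (vd X Y u) (Z u)
        + metric L u (Y u) (vd X Z u) := by
  rw [gammaF, mvfderiv_gamma hg.mdifferentiableAt]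
  have h1 : HasFDerivAt (fderiv ℝ (fderiv ℝ (energy L u.proj))) _ (vec u) :=
    ((hL.contDiffAt_fderiv_fderiv_energy hu).differentiableAt (by simp)).hasFDerivAt
  have h2 := (h1.clm_apply (hasFDerivAt_fibr (hY.piAt hu))).clm_apply
    (hasFDerivAt_fibr (hZ.piAt hu))
  refine (congrArg (fun l : E →L[ℝ] ℝ ↦ l (piE u (X u))) h2.fderiv).trans ?_
  rw [metric_eq, metric_eq, cubic_eq, vd, vd]
  simp only [ContinuousLinearMap.comp_apply, add_apply, ContinuousLinearMap.flip_apply,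
    ContinuousLinearEquiv.apply_symm_apply]
  have h3 : ∀ a b c : ℝ, a + (b + c) = c + b + a := fun a b c ↦ by ring
  exact h3 _ _ _

lemma IsFinsler.smoothFn_energy : SmoothFn (fun p ↦ energy L p.proj (vec p)) :=
  fun u hu ↦ (contMDiffAt_const.mul ((hL.smoothFn u hu).pow 2))

lemma IsFinsler.mvfderiv_energy_gamma (hu : u ∈ slit E M) (x : PiSpace E M u) :
    mvfderiv 𝓘(ℝ, E).tangent (fun p ↦ energy L p.proj (vec p)) u (gamma u x) =
      fderiv ℝ (energy L u.proj) (vec u) (piE u x) :=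
  mvfderiv_gamma (hL.smoothFn_energy u hu).mdifferentiableAt x

/-- Writes the fibre Hessian through derivatives along vertical fields on `TM`; this is what makes
`g(X, Y)` visibly smooth on `TM`, and not merely along each fibre. -/
lemma IsFinsler.mvfderiv_mvfderiv_energy (hY : SmoothPi Y)
    (hu : u ∈ slit E M) :
    mvfderiv 𝓘(ℝ, E).tangent (fun p ↦ mvfderiv 𝓘(ℝ, E).tangent
        (fun p ↦ energy L p.proj (vec p)) p (gammaF Y p)) u (gammaF X u) =
      metric L u (X u) (Y u) + mvfderiv 𝓘(ℝ, E).tangent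
        (fun p ↦ energy L p.proj (vec p)) u (gammaF (vd X Y) u) := by
  rw [gammaF, mvfderiv_gamma (hL.smoothFn_energy.mvfderiv hY.gammaF u hu).mdifferentiableAt]
  have h1 : HasFDerivAt (fderiv ℝ (energy L u.proj)) _ (vec u) :=
    ((hL.contDiffAt_fderiv_energy hu).differentiableAt (by simp)).hasFDerivAt
  have h2 := h1.clm_apply (hasFDerivAt_fibr (hY.piAt hu))
  have h3 : (fun v ↦ mvfderiv 𝓘(ℝ, E).tangent (fun p ↦ energy L p.proj (vec p)) (mkT u.proj v)
      (gammaF Y (mkT u.proj v))) =ᶠ[𝓝 (vec u)]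
      fun v ↦ fderiv ℝ (energy L u.proj) v (fibr Y u.proj v) := by
    have := (contMDiff_fibre u.proj (vec u)).continuousAt.eventually
      (eventually_of_slit hu fun p hp ↦ hp)
    filter_upwards [this] with v hv
    exact hL.mvfderiv_energy_gamma hv _
  refine (congrArg (fun l : E →L[ℝ] ℝ ↦ l (piE u (X u))) (h3.fderiv_eq.trans h2.fderiv)).trans ?_
  rw [gammaF, hL.mvfderiv_energy_gamma hu, metric_eq, vd]
  simp only [ContinuousLinearMap.comp_apply, add_apply, ContinuousLinearMap.flip_apply,
    ContinuousLinearEquiv.apply_symm_apply]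
  exact add_comm _ _

end Metric

/-! ### Smoothness of `g`, of fibre derivatives, and of the dual field. -/

section Smooth

variable {E : Type*} [NormedAddCommGroup E] [NormedSpace ℝ E] [FiniteDimensional ℝ E]
  {M : Type*} [TopologicalSpace M] [ChartedSpace E M] [IsManifold 𝓘(ℝ, E) ∞ M]
  {L : TangentBundle 𝓘(ℝ, E) M → ℝ} {u : TangentBundle 𝓘(ℝ, E) M} {D : Connection E M}
  {X Y Z : PiField E M}

/-- The fibre derivative is `D_{γX} Y - T(X, Y)`, both terms of which are already known to be
smooth. -/
lemma Connection.Regular.smoothPi_vd (hD : D.Regular) (hX : SmoothPi X) (hY : SmoothPi Y) :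
    SmoothPi (vd X Y) := by
  refine ((D.smoothPi_cov hY hX.gammaF).sub (hD.smoothPi_T hX hY)).congr fun p hp ↦ ?_
  rw [Pi.sub_apply, hD.T_eq hX hY hp, sub_sub_cancel]

lemma IsFinsler.smoothFn_metric (hL : IsFinsler L) (hD : D.Regular) (hX : SmoothPi X)
    (hY : SmoothPi Y) : SmoothFn (fun p ↦ metric L p (X p) (Y p)) := by
  intro u hu
  have h1 := (hL.smoothFn_energy.mvfderiv hY.gammaF).mvfderiv hX.gammaF u hu
  have h2 := hL.smoothFn_energy.mvfderiv (hD.smoothPi_vd hX hY).gammaF u hu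
  refine FnAt.congr (ContMDiffAt.sub h1 h2) (eventually_of_slit hu fun p hp ↦ ?_)
  refine (congrArg (fun t ↦ t - _) (hL.mvfderiv_mvfderiv_energy hY hp)).trans ?_
  rw [add_sub_cancel_right]

omit [FiniteDimensional ℝ E] in
lemma SmoothForm.smoothFn {A : PiForm E M} (hA : SmoothForm A) (hX : SmoothPi X) :
    SmoothFn (fun p ↦ A p (X p)) :=
  fun u hu ↦ (hA X hX u hu).contMDiffAt (slit_mem_nhds hu)

/-- In a local frame the coordinates of the dual field solve a linear system with the Gram matrix of
`g` as coefficients and the values of `A` on the frame as right-hand side. -/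
lemma IsFinsler.smoothPi_dualField [T2Space M] (hL : IsFinsler L) (hD : D.Regular) {A : PiForm E M}
    (hA : SmoothForm A) : SmoothPi (dualField L A) := by
  have := FiniteDimensional.complete ℝ E
  rw [smoothPi_iff]
  intro u hu
  rw [piAt_iff]
  let b := Module.finBasis ℝ E
  choose S hS hSb using fun i ↦ exists_smoothPi_eventually_trivP_eq u (b i)
  -- The Gram matrix, as a linear map.
  let f : TangentBundle 𝓘(ℝ, E) M → E →L[ℝ] (Fin (Module.finrank ℝ E) → ℝ) := fun p ↦
    ∑ i, ∑ j, metric L p (S i p) (S j p) •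
      (ContinuousLinearMap.single ℝ (fun _ ↦ ℝ) j).comp (LinearMap.toContinuousLinearMap (b.coord i))
  have hfa : ∀ p e j, f p e j = metric L p (∑ i, b.repr e i • S i p) (S j p) := by
    intro p e j
    simp [f, Finset.sum_apply, Pi.single_apply, mul_comm]
  have hf : FnAt f u := by
    refine ContMDiffAt.sum fun i _ ↦ ContMDiffAt.sum fun j _ ↦ ?_
    exact ContMDiffAt.smul (hL.smoothFn_metric hD (hS i) (hS j) u hu) contMDiffAt_const
  have hc : FnAt (fun p ↦ fun j ↦ A p (S j p)) u :=
    contMDiffAt_pi_space.2 fun j ↦ hA.smoothFn (hS j) u hu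
  -- The fields `S i` are constant in the trivialization near `u`, so they form a frame there.
  have hexp : ∀ᶠ p in 𝓝 u, ∀ x : PiSpace E M p, ∑ i, b.repr (trivP u p x) i • S i p = x := by
    filter_upwards [Filter.eventually_all.2 hSb, eventually_mem_chart u] with p hp hpc x
    have hinj : Function.Injective (trivP u p) := fun y z h ↦
      (piE p).injective (triv_injective hpc h)
    apply hinj
    simp only [map_sum, map_smul, hp]
    exact b.sum_repr _
  refine contMDiffAt_of_clm_apply_eq (f := f) hf hc ?_ ?_
  · filter_upwards [hexp, slit_mem_nhds hu] with p hp hps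
    ext j
    rw [hfa, hp, hL.metric_dualField hps]
  · have hinj : Function.Injective (f u : E →ₗ[ℝ] (Fin (Module.finrank ℝ E) → ℝ)) := by
      rw [injective_iff_map_eq_zero]
      intro e he
      obtain ⟨x, rfl⟩ := (piE u).surjective e
      have hx := hexp.self_of_nhds x
      have h1 : ∀ j, metric L u x (S j u) = 0 := by
        intro j
        rw [← hx, trivP_self, ← hfa]
        exact congrFun he j
      have h2 : metric L u x x = 0 := by
        nth_rewrite 2 [← hx]
        simp [h1]
      by_contra hne
      have h3 := hL.posDef u hu x (fun h ↦ hne (by rw [h, map_zero]))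
      exact h3.ne' h2
    let e := LinearEquiv.ofInjectiveOfFinrankEq _ hinj (by simp)
    exact ⟨e.toContinuousLinearEquiv, ContinuousLinearMap.ext fun y ↦ rfl⟩

end Smooth

/-! ### Second fibre derivatives and the fibre derivative of the cubic form. -/

section VerticalDerivative

variable {E : Type*} [NormedAddCommGroup E] [NormedSpace ℝ E]
  {M : Type*} [TopologicalSpace M] [ChartedSpace E M] [IsManifold 𝓘(ℝ, E) ∞ M]
  {L : TangentBundle 𝓘(ℝ, E) M → ℝ} {u : TangentBundle 𝓘(ℝ, E) M}
  {X Y Z : PiField E M}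

lemma vd_add (hY : SmoothPi Y) (hZ : SmoothPi Z) (hu : u ∈ slit E M) :
    vd X (Y + Z) u = vd X Y u + vd X Z u := by
  apply (piE u).injective
  rw [map_add]
  exact congrArg (fun l : E →L[ℝ] E ↦ l (piE u (X u)))
    ((hasFDerivAt_fibr (hY.piAt hu)).add (hasFDerivAt_fibr (hZ.piAt hu))).fderiv

/-- The commutator of two derivatives along the fibres. -/
lemma vd_vd_sub (hX : SmoothPi X) (hY : SmoothPi Y) (hZ : SmoothPi Z) (hu : u ∈ slit E M) :
    vd X (vd Y Z) u - vd Y (vd X Z) u = vd (vd X Y - vd Y X) Z u := by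
  have hZ1 : ContDiffAt ℝ ∞ (fderiv ℝ (fibr Z u.proj)) (vec u) :=
    (hZ.piAt hu).fibr.fderiv_right (by simp)
  have key : ∀ {X Y : PiField E M}, SmoothPi Y → piE u (vd X (vd Y Z) u) =
      fderiv ℝ (fderiv ℝ (fibr Z u.proj)) (vec u) (piE u (X u)) (piE u (Y u)) +
        fderiv ℝ (fibr Z u.proj) (vec u) (piE u (vd X Y u)) := by
    intro X Y hY
    have h1 := (hZ1.differentiableAt (by simp)).hasFDerivAt.clm_apply
      (hasFDerivAt_fibr (hY.piAt hu))
    refine (congrArg (fun l : E →L[ℝ] E ↦ l (piE u (X u))) h1.fderiv).trans ?_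
    exact add_comm _ _
  apply (piE u).injective
  have h2 := (hZ.piAt hu).fibr.isSymmSndFDerivAt minSmoothness_two_le (piE u (X u)) (piE u (Y u))
  rw [map_sub, key hY, key hX, h2, add_sub_add_left_eq_sub, ← map_sub, ← map_sub]
  exact ((piE u).apply_symm_apply _).symm

set_option maxSynthPendingDepth 3 in
lemma IsFinsler.fderiv_cubic_apply {W : PiField E M} (hL : IsFinsler L) (hY : SmoothPi Y)
    (hZ : SmoothPi Z) (hW : SmoothPi W)
    (hu : u ∈ slit E M) :
    fderiv ℝ (fun v ↦ cubic L (mkT u.proj v) (Y (mkT u.proj v)) (Z (mkT u.proj v))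
        (W (mkT u.proj v))) (vec u) (vec u) =
      -cubic L u (Y u) (Z u) (W u) + cubic L u (vd eta Y u) (Z u) (W u)
        + cubic L u (Y u) (vd eta Z u) (W u) + cubic L u (Y u) (Z u) (vd eta W u) := by
  have h1 := ((hL.contDiffAt_cubic hu).differentiableAt (by simp)).hasFDerivAt
  have h2 := ((h1.clm_apply (hasFDerivAt_fibr (hY.piAt hu))).clm_apply
    (hasFDerivAt_fibr (hZ.piAt hu))).clm_apply (hasFDerivAt_fibr (hW.piAt hu))
  refine (congrArg (fun l : E →L[ℝ] ℝ ↦ l (vec u)) h2.fderiv).trans ?_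
  simp only [ContinuousLinearMap.comp_apply, add_apply, ContinuousLinearMap.flip_apply,
    hL.fderiv_cubic_eta hu]
  have h3 : ∀ a b c d : ℝ, a + (b + (c + -d)) = -d + c + b + a := fun a b c d ↦ by ring
  exact h3 _ _ _ _

end VerticalDerivative

/-! ### The Cartan tensor. -/

section Cartan

variable {E : Type*} [NormedAddCommGroup E] [NormedSpace ℝ E] [FiniteDimensional ℝ E]
  {M : Type*} [TopologicalSpace M] [ChartedSpace E M] [IsManifold 𝓘(ℝ, E) ∞ M]
  {L : TangentBundle 𝓘(ℝ, E) M → ℝ} {u : TangentBundle 𝓘(ℝ, E) M}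

/-- The Cartan tensor, with one index raised. -/
def cartan (L : TangentBundle 𝓘(ℝ, E) M → ℝ) (u : TangentBundle 𝓘(ℝ, E) M)
    (x y : PiSpace E M u) : PiSpace E M u :=
  Function.invFun (fun a ↦ metric L u a) ((1 / 2 : ℝ) • cubic L u x y)

variable (hL : IsFinsler L)

include hL

lemma IsFinsler.metric_cartan (hu : u ∈ slit E M) (x y z : PiSpace E M u) :
    metric L u (cartan L u x y) z = (1 / 2 : ℝ) * cubic L u x y z :=
  congrArg (fun l ↦ l z)
    (Function.invFun_eq (hL.metric_surjective hu ((1 / 2 : ℝ) • cubic L u x y)))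

lemma IsFinsler.cartan_symm (hu : u ∈ slit E M) (x y : PiSpace E M u) :
    cartan L u x y = cartan L u y x :=
  hL.eq_of_metric hu fun z ↦ by rw [hL.metric_cartan hu, hL.metric_cartan hu, hL.cubic_symm hu]

lemma IsFinsler.metric_cartan_symm (hu : u ∈ slit E M) (x y z : PiSpace E M u) :
    metric L u (cartan L u x y) z = metric L u (cartan L u x z) y := by
  rw [hL.metric_cartan hu, hL.metric_cartan hu, hL.cubic_symm' hu]

lemma IsFinsler.cartan_eta (hu : u ∈ slit E M) (x : PiSpace E M u) :
    cartan L u (eta u) x = 0 :=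
  hL.eq_of_metric hu fun z ↦ by
    rw [hL.metric_cartan hu, hL.cubic_eta hu]
    simp

lemma IsFinsler.cartan_add_right (hu : u ∈ slit E M) (x y y' : PiSpace E M u) :
    cartan L u x (y + y') = cartan L u x y + cartan L u x y' :=
  hL.eq_of_metric hu fun z ↦ by
    simp only [map_add, add_apply, hL.metric_cartan hu]
    ring

lemma IsFinsler.cartan_smul_right (hu : u ∈ slit E M) (c : ℝ) (x y : PiSpace E M u) :
    cartan L u x (c • y) = c • cartan L u x y :=
  hL.eq_of_metric hu fun z ↦ by
    simp only [map_smul, smul_apply, hL.metric_cartan hu, smul_eq_mul]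
    ring

lemma IsFinsler.cartan_add_left (hu : u ∈ slit E M) (x x' y : PiSpace E M u) :
    cartan L u (x + x') y = cartan L u x y + cartan L u x' y := by
  rw [hL.cartan_symm hu, hL.cartan_add_right hu, hL.cartan_symm hu y, hL.cartan_symm hu y]

lemma IsFinsler.cartan_smul_left (hu : u ∈ slit E M) (c : ℝ) (x y : PiSpace E M u) :
    cartan L u (c • x) y = c • cartan L u x y := by
  rw [hL.cartan_symm hu, hL.cartan_smul_right hu, hL.cartan_symm hu y]

lemma IsFinsler.cartan_zero_right (hu : u ∈ slit E M) (x : PiSpace E M u) :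
    cartan L u x 0 = 0 := by
  have h := hL.cartan_add_right hu x 0 0
  rwa [add_zero, left_eq_add] at h

end Cartan

/-! ### Consequences of (C2) and (C4) alone. -/

namespace Connection

variable {E : Type*} [NormedAddCommGroup E] [NormedSpace ℝ E]
  {M : Type*} [TopologicalSpace M] [ChartedSpace E M] [IsManifold 𝓘(ℝ, E) ∞ M]
  {L : TangentBundle 𝓘(ℝ, E) M → ℝ} {u : TangentBundle 𝓘(ℝ, E) M}
  {X Y Z : PiField E M} {D : Connection E M}

/-- `D` is regular, vertically metric, and its (h)hv-torsion is `g`-symmetric. -/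
structure IsVerticallyCartan (D : Connection E M) (L : TangentBundle 𝓘(ℝ, E) M → ℝ) : Prop where
  regular : D.Regular
  vertMetric : ∀ X Y Z : PiField E M, SmoothPi X → SmoothPi Y → SmoothPi Z → ∀ u ∈ slit E M,
    D.covMetric L (gammaF X) Y Z u = 0
  hvTorsion : ∀ X Y Z : PiField E M, SmoothPi X → SmoothPi Y → SmoothPi Z → ∀ u ∈ slit E M,
    metric L u (D.T X Y u) (Z u) = metric L u (D.T X Z u) (Y u)

lemma IsCartan.isVerticallyCartan (h : D.IsCartan L) : D.IsVerticallyCartan L :=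
  ⟨h.regular, h.vertMetric, h.hvTorsion⟩

lemma IsHRF.isVerticallyCartan {A : PiForm E M} (h : D.IsHRF L A) : D.IsVerticallyCartan L :=
  ⟨h.regular, h.vertical, h.hvTorsion⟩

variable [FiniteDimensional ℝ E]

/-- In `(D_{γX} g)(Y, Z) = 0`, writing `D_{γX}` as fibre derivative plus `T(X, ·)` leaves the cubic
form equal to `g(T(X, Y), Z) + g(Y, T(X, Z))`; (C4) makes these two terms equal. -/
lemma IsVerticallyCartan.two_mul_metric_T (hL : IsFinsler L) (hD : D.IsVerticallyCartan L)
    (hX : SmoothPi X) (hY : SmoothPi Y) (hZ : SmoothPi Z) (hu : u ∈ slit E M) :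
    2 * metric L u (D.T X Y u) (Z u) = cubic L u (X u) (Y u) (Z u) := by
  have h1 := hD.vertMetric X Y Z hX hY hZ u hu
  have h2 := hD.hvTorsion X Y Z hX hY hZ u hu
  have hT : ∀ {Y}, SmoothPi Y → D.cov (gammaF X) Y u = D.T X Y u + vd X Y u := fun hY ↦ by
    rw [hD.regular.T_eq hX hY hu, sub_add_cancel]
  rw [covMetric, hL.mvfderiv_metric_gamma hY hZ hu (hL.smoothFn_metric hD.regular hY hZ u hu),
    hT hY, hT hZ] at h1
  simp only [map_add, add_apply] at h1
  rw [hL.metric_symm hu (Y u) (D.T X Z u)] at h1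
  linarith

variable [T2Space M]

lemma IsVerticallyCartan.T_eq_cartan (hL : IsFinsler L) (hD : D.IsVerticallyCartan L)
    (hX : SmoothPi X) (hY : SmoothPi Y) (hu : u ∈ slit E M) :
    D.T X Y u = cartan L u (X u) (Y u) :=
  hL.eq_of_metric hu fun z ↦ by
    obtain ⟨Z, hZ, rfl⟩ := exists_smoothPi_eq u z
    rw [hL.metric_cartan hu, ← hD.two_mul_metric_T hL hX hY hZ hu]
    ring

lemma IsVerticallyCartan.cov_gammaF (hL : IsFinsler L) (hD : D.IsVerticallyCartan L)
    (hX : SmoothPi X) (hY : SmoothPi Y) (hu : u ∈ slit E M) :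
    D.cov (gammaF X) Y u = vd X Y u + cartan L u (X u) (Y u) := by
  rw [← hD.T_eq_cartan hL hX hY hu, hD.regular.T_eq hX hY hu, add_sub_cancel]

/-- The connection map is the identity on vertical vectors. -/
lemma IsVerticallyCartan.connMap_gamma (hL : IsFinsler L) (hD : D.IsVerticallyCartan L)
    (hu : u ∈ slit E M) (x : PiSpace E M u) : D.connMap u (gamma u x) = x := by
  obtain ⟨X, hX, rfl⟩ := exists_smoothPi_eq u x
  have h := hD.cov_gammaF hL hX smoothPi_eta hu
  rwa [vd_eta, hL.cartan_symm hu, hL.cartan_eta hu, add_zero] at h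

/-- The Cartan tensor is homogeneous of degree `-1`. -/
lemma IsVerticallyCartan.vd_eta_T (hL : IsFinsler L) (hD : D.IsVerticallyCartan L)
    (hY : SmoothPi Y) (hZ : SmoothPi Z) (hu : u ∈ slit E M) :
    vd eta (D.T Y Z) u = cartan L u (vd eta Y u) (Z u) + cartan L u (Y u) (vd eta Z u)
      - cartan L u (Y u) (Z u) :=
  hL.eq_of_metric hu fun w ↦ by
    obtain ⟨W, hW, rfl⟩ := exists_smoothPi_eq u w
    have hT := hD.regular.smoothPi_T hY hZ
    have hg := hL.smoothFn_metric hD.regular hT hW u hu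
    -- The derivative of `g(T(Y, Z), W)` along `γη` is computed twice: by the product rule, where
    -- the derivative of `g` drops out, and as half the cubic form, which has degree `-1`.
    have h1 := hL.mvfderiv_metric_gamma (X := eta) hT hW hu hg
    rw [gammaF, mvfderiv_gamma hg.mdifferentiableAt, hL.cubic_eta hu] at h1
    have h2 : (fun v ↦ metric L (mkT u.proj v) (D.T Y Z (mkT u.proj v)) (W (mkT u.proj v)))
        =ᶠ[𝓝 (vec u)] fun v ↦ (1 / 2 : ℝ) * cubic L (mkT u.proj v) (Y (mkT u.proj v))
          (Z (mkT u.proj v)) (W (mkT u.proj v)) := by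
      have := (contMDiff_fibre u.proj (vec u)).continuousAt.eventually
        (eventually_of_slit hu fun p hp ↦ hp)
      filter_upwards [this] with v hv
      rw [hD.T_eq_cartan hL hY hZ hv, hL.metric_cartan hv]
    have h3 := hL.fderiv_cubic_apply hY hZ hW hu
    have h4 : fderiv ℝ (fun v ↦ metric L (mkT u.proj v) (D.T Y Z (mkT u.proj v))
        (W (mkT u.proj v))) (vec u) (vec u) = (1 / 2 : ℝ) *
          (-cubic L u (Y u) (Z u) (W u) + cubic L u (vd eta Y u) (Z u) (W u)
            + cubic L u (Y u) (vd eta Z u) (W u) + cubic L u (Y u) (Z u) (vd eta W u)) := by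
      have h5 := fderiv_const_smul_field (𝕜 := ℝ) (f := fun v ↦
        cubic L (mkT u.proj v) (Y (mkT u.proj v)) (Z (mkT u.proj v)) (W (mkT u.proj v)))
        (1 / 2 : ℝ)
      rw [h2.fderiv_eq, ← h3]
      exact congrArg (fun l : E → E →L[ℝ] ℝ ↦ l (vec u) (vec u)) h5
    have h6 := h4.symm.trans h1
    rw [hD.T_eq_cartan hL hY hZ hu, hL.metric_cartan hu] at h6
    simp only [map_add, map_sub, add_apply, sub_apply, zero_apply, hL.metric_cartan hu] at h6 ⊢
    linarith

/-- The v-curvature vanishes if one of the arguments is the fundamental field. -/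
lemma IsVerticallyCartan.S_eta (hL : IsFinsler L) (hD : D.IsVerticallyCartan L)
    (hY : SmoothPi Y) (hZ : SmoothPi Z) (hu : u ∈ slit E M) :
    D.S eta Y Z u = 0 := by
  have := FiniteDimensional.complete ℝ E
  have hvd := hD.regular.smoothPi_vd (smoothPi_eta) hZ
  have hvd' := hD.regular.smoothPi_vd hY hZ
  have hT := hD.regular.smoothPi_T hY hZ
  have h1 : ∀ p ∈ slit E M, D.cov (gammaF eta) Z p = vd eta Z p := fun p hp ↦ by
    rw [hD.cov_gammaF hL smoothPi_eta hZ hp, hL.cartan_eta hp, add_zero]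
  have h2 : ∀ p ∈ slit E M, D.cov (gammaF Y) Z p = (vd Y Z + D.T Y Z) p := fun p hp ↦ by
    rw [Pi.add_apply, hD.cov_gammaF hL hY hZ hp, hD.T_eq_cartan hL hY hZ hp]
  have h3 : vd eta (vd Y Z + D.T Y Z) u = vd eta (vd Y Z) u + vd eta (D.T Y Z) u :=
    vd_add hvd' hT hu
  have hb : SmoothPi (vd eta Y - Y) := (hD.regular.smoothPi_vd smoothPi_eta hY).sub hY
  -- The bracket contains `-Y` because the fibre derivative of `η` along `Y` is `Y`. The resulting
  -- `-C(Y, Z)` is exactly what the degree `-1` of `C` compensates.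
  have h4 : D.cov (VectorField.mlieBracket 𝓘(ℝ, E).tangent (gammaF eta) (gammaF Y)) Z u =
      D.cov (gammaF (vd eta Y - Y)) Z u := by
    refine D.cov_congr hZ ?_ (fun _ _ ↦ rfl) hu
    rw [mlieBracket_gammaF (smoothPi_eta.piAt hu) (hY.piAt hu), vd_eta]
    rfl
  have h5 := vd_vd_sub smoothPi_eta hY hZ hu
  rw [show vd Y eta = Y from funext fun p ↦ vd_eta] at h5
  have h6 : cartan L u ((vd eta Y - Y) u) (Z u) =
      cartan L u (vd eta Y u) (Z u) - cartan L u (Y u) (Z u) := by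
    rw [eq_sub_iff_add_eq, ← hL.cartan_add_left hu, Pi.sub_apply, sub_add_cancel]
  rw [S, curvature, Pi.add_apply, Pi.add_apply, Pi.neg_apply, h4,
    D.cov_congr (D.smoothPi_cov hZ hY.gammaF) rfl h2 hu,
    D.cov_congr (D.smoothPi_cov hZ smoothPi_eta.gammaF) rfl h1 hu,
    hD.cov_gammaF hL smoothPi_eta (hvd'.add hT) hu, hD.cov_gammaF hL hY hvd hu,
    hD.cov_gammaF hL hb hZ hu, hL.cartan_eta hu, h3, hD.vd_eta_T hL hY hZ hu, h6, ← h5]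
  abel

end Connection

/-! ### The tensors `N` and `X_t` on individual vectors. -/

section DifferenceTensor

variable {E : Type*} [NormedAddCommGroup E] [NormedSpace ℝ E]
  {M : Type*} [TopologicalSpace M] [ChartedSpace E M] [IsManifold 𝓘(ℝ, E) ∞ M]
  {L : TangentBundle 𝓘(ℝ, E) M → ℝ} {A : PiForm E M} {u : TangentBundle 𝓘(ℝ, E) M}

/-- The difference tensor `N`, as a map on vectors. -/
def nTensor (L : TangentBundle 𝓘(ℝ, E) M → ℝ) (A : PiForm E M) (u : TangentBundle 𝓘(ℝ, E) M)
    (x y : PiSpace E M u) : PiSpace E M u :=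
  let a := dualField L A u
  (1 / 2 : ℝ) •
    (metric L u x y • a - A u x • y - A u y • x
      - (L u * ell L u y) • cartan L u a x
      + metric L u (cartan L u a x) y • eta u
      + (L u ^ 2) • (cartan L u (cartan L u a y) x - cartan L u (cartan L u x y) a))

/-- The shift `x ↦ x_t`, as a map on vectors. -/
def shiftTensor (L : TangentBundle 𝓘(ℝ, E) M → ℝ) (A : PiForm E M) (u : TangentBundle 𝓘(ℝ, E) M)
    (x : PiSpace E M u) : PiSpace E M u :=
  let a := dualField L A u
  (1 / 2 : ℝ) •
    (A u x • eta u + A u (eta u) • x - metric L u x (eta u) • a + (L u ^ 2) • cartan L u a x)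

variable [FiniteDimensional ℝ E] (hL : IsFinsler L)

include hL

lemma IsFinsler.nTensor_add_left (hu : u ∈ slit E M) (x x' y : PiSpace E M u) :
    nTensor L A u (x + x') y = nTensor L A u x y + nTensor L A u x' y := by
  simp only [nTensor, map_add, add_apply, hL.cartan_add_left hu, hL.cartan_add_right hu]
  module

lemma IsFinsler.nTensor_add_right (hu : u ∈ slit E M) (x y y' : PiSpace E M u) :
    nTensor L A u x (y + y') = nTensor L A u x y + nTensor L A u x y' := by
  simp only [nTensor, map_add, hL.cartan_add_left hu, hL.cartan_add_right hu]
  module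

lemma IsFinsler.nTensor_zero_left (hu : u ∈ slit E M) (y : PiSpace E M u) :
    nTensor L A u 0 y = 0 := by
  have h := hL.nTensor_add_left (A := A) hu 0 0 y
  rwa [add_zero, left_eq_add] at h

lemma IsFinsler.nTensor_zero_right (hu : u ∈ slit E M) (x : PiSpace E M u) :
    nTensor L A u x 0 = 0 := by
  have h := hL.nTensor_add_right (A := A) hu x 0 0
  rwa [add_zero, left_eq_add] at h

lemma IsFinsler.nTensor_neg_left (hu : u ∈ slit E M) (x y : PiSpace E M u) :
    nTensor L A u (-x) y = -nTensor L A u x y := by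
  rw [eq_neg_iff_add_eq_zero, ← hL.nTensor_add_left hu, neg_add_cancel, hL.nTensor_zero_left hu]

lemma IsFinsler.metric_nTensor (hu : u ∈ slit E M) (x y z : PiSpace E M u) :
    2 * metric L u (nTensor L A u x y) z =
      metric L u x y * A u z - A u x * metric L u y z - A u y * metric L u x z
        - metric L u (eta u) y * metric L u (cartan L u (dualField L A u) x) z
        + metric L u (cartan L u (dualField L A u) x) y * metric L u (eta u) z
        + L u ^ 2 * (metric L u (cartan L u (cartan L u (dualField L A u) y) x) z
          - metric L u (cartan L u (cartan L u x y) (dualField L A u)) z) := by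
  simp only [nTensor, map_smul, map_add, map_sub, add_apply, sub_apply, smul_apply, smul_eq_mul,
    hL.ell_eq hu, hL.metric_dualField hu]
  ring

lemma IsFinsler.metric_shiftTensor (hu : u ∈ slit E M) (x z : PiSpace E M u) :
    2 * metric L u (shiftTensor L A u x) z =
      A u x * metric L u (eta u) z + A u (eta u) * metric L u x z - metric L u x (eta u) * A u z
        + L u ^ 2 * metric L u (cartan L u (dualField L A u) x) z := by
  simp only [shiftTensor, map_smul, map_add, map_sub, add_apply, sub_apply, smul_apply,
    smul_eq_mul, hL.metric_dualField hu]
  ring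

end DifferenceTensor

/-! ### Determination of the difference of the two connections. -/

namespace Connection

variable {E : Type*} [NormedAddCommGroup E] [NormedSpace ℝ E]
  {M : Type*} [TopologicalSpace M] [ChartedSpace E M] [IsManifold 𝓘(ℝ, E) ∞ M]
  {L : TangentBundle 𝓘(ℝ, E) M → ℝ} {A : PiForm E M} {u : TangentBundle 𝓘(ℝ, E) M}
  {X Y Z : PiField E M} {V W : VField E M} {D D' : Connection E M}

lemma covMetric_congr (h : V u = W u) : D.covMetric L V Y Z u = D.covMetric L W Y Z u := by
  simp only [covMetric, cov, h]

lemma covMetric_add_left :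
    D.covMetric L (V + W) Y Z u = D.covMetric L V Y Z u + D.covMetric L W Y Z u := by
  simp only [covMetric, cov_add_left, Pi.add_apply, map_add, add_apply]
  ring

lemma Regular.difference_eta (hD' : D'.Regular) (hu : u ∈ slit E M) :
    D'.cov (D'.betaF X) eta u - D.cov (D'.betaF X) eta u = -D.cov (D'.betaF X) eta u := by
  have h : D'.cov (D'.betaF X) eta u = 0 := hD'.connMap_betaF hu X
  rw [h, zero_sub]

variable [FiniteDimensional ℝ E] [T2Space M]

section

variable (hL : IsFinsler L) (hD : D.IsVerticallyCartan L)

include hL hD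

/-- `N` is built from torsions of fields and so is not visibly tensorial; replacing each `T` by the
Cartan tensor makes it pointwise. -/
lemma IsVerticallyCartan.N_eq (hA : SmoothForm A) (hX : SmoothPi X) (hY : SmoothPi Y)
    (hu : u ∈ slit E M) : D.N L A X Y u = nTensor L A u (X u) (Y u) := by
  have ha := hL.smoothPi_dualField hD.regular hA
  have hT : ∀ {X Y}, SmoothPi X → SmoothPi Y → D.T X Y u = cartan L u (X u) (Y u) :=
    fun hX hY ↦ hD.T_eq_cartan hL hX hY hu
  rw [N, nTensor]
  simp only [hT ha hX, hT ha hY, hT hX hY, hT (hD.regular.smoothPi_T ha hY) hX,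
    hT (hD.regular.smoothPi_T hX hY) ha]

lemma IsVerticallyCartan.shift_eq (hA : SmoothForm A) (hX : SmoothPi X) (hu : u ∈ slit E M) :
    D.shift L A X u = shiftTensor L A u (X u) := by
  rw [shift, shiftTensor]
  simp only [hD.T_eq_cartan hL (hL.smoothPi_dualField hD.regular hA) hX hu]

lemma IsVerticallyCartan.smoothPi_N (hA : SmoothForm A) (hX : SmoothPi X) (hY : SmoothPi Y) :
    SmoothPi (D.N L A X Y) := by
  have ha := hL.smoothPi_dualField hD.regular hA
  have hT : ∀ {X Y}, SmoothPi X → SmoothPi Y → SmoothPi (D.T X Y) := hD.regular.smoothPi_T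
  have hg : ∀ {X Y}, SmoothPi X → SmoothPi Y → SmoothFn (fun p ↦ metric L p (X p) (Y p)) :=
    hL.smoothFn_metric hD.regular
  have hl : SmoothFn (fun p ↦ L p * ell L p (Y p)) :=
    (hg smoothPi_eta hY).congr fun p hp ↦ (hL.ell_eq hp _).symm
  have hL2 : SmoothFn (fun p ↦ L p ^ 2) := fun u hu ↦ ContMDiffAt.pow (hL.smoothFn u hu) 2
  exact ((((((ha.smul (hg hX hY)).sub (hY.smul (hA.smoothFn hX))).sub
    (hX.smul (hA.smoothFn hY))).sub ((hT ha hX).smul hl)).add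
    (smoothPi_eta.smul (hg (hT ha hX) hY))).add
    (((hT (hT ha hY) hX).sub (hT (hT hX hY) ha)).smul hL2)).const_smul _

lemma IsVerticallyCartan.smoothPi_shift (hA : SmoothForm A) (hX : SmoothPi X) :
    SmoothPi (D.shift L A X) := by
  have ha := hL.smoothPi_dualField hD.regular hA
  have hL2 : SmoothFn (fun p ↦ L p ^ 2) := fun u hu ↦ ContMDiffAt.pow (hL.smoothFn u hu) 2
  exact ((((smoothPi_eta.smul (hA.smoothFn hX)).add (hX.smul (hA.smoothFn smoothPi_eta))).sub
    (ha.smul (hL.smoothFn_metric hD.regular hX smoothPi_eta))).add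
    ((hD.regular.smoothPi_T ha hX).smul hL2)).const_smul _

end

variable (hL : IsFinsler L) (hD : D.IsCartan L) (hD' : D'.IsHRF L A)

include hL hD hD'

/-- Subtracting `γ K(β'X)` from `β'X` leaves a `D`-horizontal vector, as `K γ = 1`, and does not
change its image under `ρ`. -/
lemma betaF_eq_betaF_add_gamma (hu : u ∈ slit E M) (X : PiField E M) :
    D'.betaF X u = D.betaF X u + gamma u (D.cov (D'.betaF X) eta u) := by
  rw [← sub_eq_iff_eq_add]
  symm
  apply hD.regular.betaF_eq hu
  · rw [map_sub, hD'.regular.rho_betaF hu, rho_gamma, sub_zero]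
  · rw [map_sub, hD.isVerticallyCartan.connMap_gamma hL hu]
    exact sub_self _

/-- Along `β'X`, `g` is recurrent for `D'` and parallel for `D`; subtracting cancels the derivative
of `g(Y, Z)`. -/
lemma metric_difference (hX : SmoothPi X) (hY : SmoothPi Y) (hZ : SmoothPi Z)
    (hu : u ∈ slit E M) :
    metric L u (D'.cov (D'.betaF X) Y u - D.cov (D'.betaF X) Y u) (Z u)
      + metric L u (D'.cov (D'.betaF X) Z u - D.cov (D'.betaF X) Z u) (Y u)
      = -(A u (X u) * metric L u (Y u) (Z u)) := by
  have hn : SmoothPi (D.cov (D'.betaF X) eta) :=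
    D.smoothPi_cov smoothPi_eta (hD'.regular.smoothV_betaF hX)
  have h1 := hD'.recurrent X Y Z hX hY hZ u hu
  have h2 : D.covMetric L (D'.betaF X) Y Z u = 0 := by
    rw [covMetric_congr (W := D.betaF X + gammaF (D.cov (D'.betaF X) eta))
      (betaF_eq_betaF_add_gamma hL hD hD' hu X), covMetric_add_left,
      hD.horMetric X Y Z hX hY hZ u hu, hD.vertMetric _ Y Z hn hY hZ u hu, add_zero]
  rw [covMetric] at h1 h2
  rw [hL.metric_symm hu (Y u)] at h1 h2
  simp only [map_sub, sub_apply]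
  linarith

/-- Both torsions are evaluated on the same pair `β'X, β'Y`, so the bracket cancels. The torsion of
`D'` vanishes there; that of `D` comes only from the vertical parts of `β'X` and `β'Y`. -/
lemma difference_sub_difference (hX : SmoothPi X) (hY : SmoothPi Y) (hu : u ∈ slit E M) :
    (D'.cov (D'.betaF X) Y u - D.cov (D'.betaF X) Y u)
      - (D'.cov (D'.betaF Y) X u - D.cov (D'.betaF Y) X u)
      = cartan L u (D.cov (D'.betaF Y) eta u) (X u)
        - cartan L u (D.cov (D'.betaF X) eta u) (Y u) := by
  have hbX := hD'.regular.smoothV_betaF hX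
  have hbY := hD'.regular.smoothV_betaF hY
  have hnX : SmoothPi (D.cov (D'.betaF X) eta) := D.smoothPi_cov smoothPi_eta hbX
  have hnY : SmoothPi (D.cov (D'.betaF Y) eta) := D.smoothPi_cov smoothPi_eta hbY
  have hv := hD.isVerticallyCartan
  have h1 := hD'.hTorsion X Y hX hY u hu
  have h2 := torsion_horizontal_add_vertical hD.regular hX hY hnX hnY
    (fun p hp ↦ betaF_eq_betaF_add_gamma hL hD hD' hp X)
    (fun p hp ↦ betaF_eq_betaF_add_gamma hL hD hD' hp Y) hu
  rw [hD.hTorsion X Y hX hY u hu, hv.T_eq_cartan hL hnX hY hu, hv.T_eq_cartan hL hnY hX hu,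
    zero_add] at h2
  have hr : ∀ {X}, SmoothPi X → ∀ D₁ : Connection E M, ∀ V,
      D₁.cov V (rhoF (D'.betaF X)) u = D₁.cov V X u := fun hX D₁ V ↦
    (D₁.cov_congr hX rfl (fun p hp ↦ (hD'.regular.rho_betaF hp _).symm) hu).symm
  simp only [Q, torsion, Pi.sub_apply, hr hX, hr hY] at h1 h2
  rw [← neg_sub (cartan L u _ (Y u)), ← h2]
  have h3 := sub_eq_zero.1 h1
  rw [← h3]
  abel

/-- The difference of the two connections along the horizontal fields. -/
lemma two_mul_metric_difference (hX : SmoothPi X) (hY : SmoothPi Y) (hZ : SmoothPi Z)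
    (hu : u ∈ slit E M) :
    2 * metric L u (D'.cov (D'.betaF X) Y u - D.cov (D'.betaF X) Y u) (Z u) =
      A u (Z u) * metric L u (X u) (Y u) - A u (X u) * metric L u (Y u) (Z u)
        - A u (Y u) * metric L u (X u) (Z u)
        + 2 * metric L u (cartan L u (D.cov (D'.betaF Y) eta u) (X u)) (Z u)
        - 2 * metric L u (cartan L u (D.cov (D'.betaF Z) eta u) (X u)) (Y u) := by
  have key : ∀ {X Y Z : PiField E M}, SmoothPi X → SmoothPi Y →
      metric L u (D'.cov (D'.betaF X) Y u - D.cov (D'.betaF X) Y u) (Z u)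
        - metric L u (D'.cov (D'.betaF Y) X u - D.cov (D'.betaF Y) X u) (Z u)
      = metric L u (cartan L u (D.cov (D'.betaF Y) eta u) (X u)) (Z u)
        - metric L u (cartan L u (D.cov (D'.betaF X) eta u) (Y u)) (Z u) := by
    intro X Y Z hX hY
    have h := congrArg (fun x ↦ metric L u x (Z u))
      (difference_sub_difference hL hD hD' hX hY hu)
    simpa only [map_sub, sub_apply] using h
  -- Koszul's trick: with these six relations numbered as below, the combination is `h1 + h2 - h3 +
  -- h4 - h5 - h6`, after the total symmetry of `C` has aligned the Cartan terms.
  have h1 := metric_difference hL hD hD' hX hY hZ hu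
  have h2 := metric_difference hL hD hD' hY hX hZ hu
  have h3 := metric_difference hL hD hD' hZ hX hY hu
  have h4 := key (Z := Z) hX hY
  have h5 := key (Z := Y) hX hZ
  have h6 := key (Z := X) hY hZ
  rw [hL.metric_cartan_symm hu _ (Z u) (Y u)] at h5
  rw [hL.metric_cartan_symm hu _ (Z u) (X u), hL.metric_cartan_symm hu _ (Y u) (X u)] at h6
  linarith

/-- The difference formula at `Y = η` involves the unknown only through `C(n(η), X)`. At `X = η`
even this term vanishes and `n(η)` is explicit; feeding it back determines `n(X)`. -/
lemma cov_betaF_eta (hX : SmoothPi X) (hu : u ∈ slit E M) :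
    D.cov (D'.betaF X) eta u = shiftTensor L A u (X u) := by
  have hce : ∀ x, cartan L u x (eta u) = 0 := fun x ↦ by
    rw [hL.cartan_symm hu, hL.cartan_eta hu]
  have h0 : ∀ {X Z : PiField E M}, SmoothPi X → SmoothPi Z →
      2 * metric L u (D.cov (D'.betaF X) eta u) (Z u) =
        A u (X u) * metric L u (eta u) (Z u) + A u (eta u) * metric L u (X u) (Z u)
          - A u (Z u) * metric L u (X u) (eta u)
          - 2 * metric L u (cartan L u (D.cov (D'.betaF eta) eta u) (X u)) (Z u) := by
    intro X Z hX hZ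
    have h := two_mul_metric_difference hL hD hD' hX smoothPi_eta hZ hu
    rw [hD'.regular.difference_eta hu, hL.metric_cartan_symm hu _ (X u) (eta u), hce] at h
    simp only [map_neg, neg_apply, map_zero, zero_apply] at h
    linarith
  have h1 : D.cov (D'.betaF eta) eta u =
      A u (eta u) • eta u - ((1 / 2 : ℝ) * L u ^ 2) • dualField L A u := by
    refine hL.eq_of_metric hu fun z ↦ ?_
    obtain ⟨Z, hZ, rfl⟩ := exists_smoothPi_eq u z
    have h := h0 smoothPi_eta hZ
    rw [hce, hL.metric_eta_eta hu] at h
    simp only [map_sub, map_smul, sub_apply, smul_apply, smul_eq_mul, map_zero, zero_apply,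
      hL.metric_dualField hu] at h ⊢
    linarith
  have h2 : cartan L u (D.cov (D'.betaF eta) eta u) (X u) =
      -(((1 / 2 : ℝ) * L u ^ 2) • cartan L u (dualField L A u) (X u)) := by
    rw [h1, sub_eq_add_neg, ← neg_smul, hL.cartan_add_left hu, hL.cartan_smul_left hu,
      hL.cartan_smul_left hu, hL.cartan_eta hu, smul_zero, zero_add, neg_smul]
  refine hL.eq_of_metric hu fun z ↦ ?_
  obtain ⟨Z, hZ, rfl⟩ := exists_smoothPi_eq u z
  have h := h0 hX hZ
  have h3 := hL.metric_shiftTensor (A := A) hu (X u) (Z u)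
  rw [h2] at h
  simp only [map_neg, map_smul, neg_apply, smul_apply, smul_eq_mul] at h
  linarith

/-- With the vertical shift known, the right-hand side of `two_mul_metric_difference` is explicit.
The `A(η)` terms cancel by total symmetry of `C`, and what remains is `N`. -/
lemma cov_betaF_eq (hX : SmoothPi X) (hY : SmoothPi Y) (hu : u ∈ slit E M) :
    D'.cov (D'.betaF X) Y u = D.cov (D'.betaF X) Y u + nTensor L A u (X u) (Y u) := by
  rw [← sub_eq_iff_eq_add']
  refine hL.eq_of_metric hu fun z ↦ ?_
  obtain ⟨Z, hZ, rfl⟩ := exists_smoothPi_eq u z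
  have h := two_mul_metric_difference hL hD hD' hX hY hZ hu
  have h1 := hL.metric_nTensor (A := A) hu (X u) (Y u) (Z u)
  have key : ∀ y x z : PiSpace E M u, 2 * metric L u (cartan L u (shiftTensor L A u y) x) z =
      A u (eta u) * metric L u (cartan L u y x) z
        - metric L u y (eta u) * metric L u (cartan L u (dualField L A u) x) z
        + L u ^ 2 * metric L u (cartan L u (cartan L u (dualField L A u) y) x) z := by
    intro y x z
    simp only [shiftTensor, hL.cartan_add_left hu, hL.cartan_smul_left hu, sub_eq_add_neg,
      ← neg_smul, hL.cartan_eta hu, smul_zero, zero_add, map_add, map_smul, add_apply, smul_apply,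
      smul_eq_mul]
    ring
  rw [cov_betaF_eta hL hD hD' hY hu, cov_betaF_eta hL hD hD' hZ hu, key, key] at h
  have h2 : metric L u (cartan L u (cartan L u (dualField L A u) (Z u)) (X u)) (Y u) =
      metric L u (cartan L u (cartan L u (X u) (Y u)) (dualField L A u)) (Z u) := by
    rw [hL.cartan_symm hu _ (X u), hL.metric_cartan_symm hu (X u), hL.metric_symm hu,
      hL.metric_cartan_symm hu, hL.cartan_symm hu (dualField L A u) (cartan _ _ _ _)]
  have h3 : metric L u (cartan L u (Z u) (X u)) (Y u) =
      metric L u (cartan L u (Y u) (X u)) (Z u) := by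
    rw [hL.cartan_symm hu, hL.metric_cartan_symm hu, hL.cartan_symm hu]
  rw [hL.metric_symm hu (Y u) (eta u), hL.metric_symm hu (Z u) (eta u), h2, h3] at h
  linarith

/-- The difference of the two connections is the tensor `N`. -/
lemma toFun_eq (hY : SmoothPi Y) (hu : u ∈ slit E M)
    (w : TangentSpace 𝓘(ℝ, E).tangent u) :
    D'.toFun Y u w = D.toFun Y u w + nTensor L A u (rho u w) (Y u) := by
  obtain ⟨X, hX, hXu⟩ := exists_smoothPi_eq u (rho u w)
  -- Every vector is `D'`-horizontal plus vertical, and on the vertical part the two connections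
  -- agree.
  obtain ⟨v, hv⟩ : ∃ v, w - D'.betaF X u = gamma u v := by
    apply exists_gamma_of_rho_eq_zero
    rw [map_sub, hD'.regular.rho_betaF hu, hXu, sub_self]
  obtain ⟨V, hV, rfl⟩ := exists_smoothPi_eq u v
  have h1 : D'.toFun Y u (gamma u (V u)) = D.toFun Y u (gamma u (V u)) :=
    (hD'.isVerticallyCartan.cov_gammaF hL hV hY hu).trans
      (hD.isVerticallyCartan.cov_gammaF hL hV hY hu).symm
  have h2 : D'.toFun Y u (D'.betaF X u) = D.toFun Y u (D'.betaF X u) + _ :=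
    cov_betaF_eq hL hD hD' hX hY hu
  rw [sub_eq_iff_eq_add.1 hv, map_add, map_add, h1, h2, map_add, rho_gamma,
    hD'.regular.rho_betaF hu, zero_add]
  abel

end Connection

/-! ### Comparison of the curvatures. -/

namespace Connection

variable {E : Type*} [NormedAddCommGroup E] [NormedSpace ℝ E] [FiniteDimensional ℝ E]
  {M : Type*} [TopologicalSpace M] [ChartedSpace E M] [IsManifold 𝓘(ℝ, E) ∞ M]
  {L : TangentBundle 𝓘(ℝ, E) M → ℝ} {A : PiForm E M} {u : TangentBundle 𝓘(ℝ, E) M}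
  {X X' Y Z : PiField E M} {V W : VField E M} {D D' : Connection E M}

section VCurvature

lemma S_add_left (hX : SmoothPi X) (hX' : SmoothPi X') (hZ : SmoothPi Z)
    (hu : u ∈ slit E M) : D.S (X + X') Y Z u = D.S X Y Z u + D.S X' Y Z u := by
  have := FiniteDimensional.complete ℝ E
  have h : gammaF (X + X') = gammaF X + gammaF X' := funext fun p ↦ map_add (gamma p) _ _
  rw [S, h]
  exact D.curvature_add_left hZ hX.gammaF hX'.gammaF hu

lemma S_smul_left {f : TangentBundle 𝓘(ℝ, E) M → ℝ} (hf : SmoothFn f) (hX : SmoothPi X)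
    (hZ : SmoothPi Z) (hu : u ∈ slit E M) :
    D.S (fun p ↦ f p • X p) Y Z u = f u • D.S X Y Z u := by
  have := FiniteDimensional.complete ℝ E
  have h : gammaF (fun p ↦ f p • X p) = fun p ↦ f p • gammaF X p :=
    funext fun p ↦ map_smul (gamma p) _ _
  rw [S, h]
  exact D.curvature_smul_left hf hZ hX.gammaF hu

end VCurvature

variable [T2Space M] (hL : IsFinsler L)

include hL

/-- Linearity of `S` over smooth functions in its first slot; of the four summands of `X_t`, the one
along `η` is killed by `S_eta`. -/
lemma IsVerticallyCartan.S_shift (hD : D.IsVerticallyCartan L) (hA : SmoothForm A)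
    (hX : SmoothPi X) (hY : SmoothPi Y) (hZ : SmoothPi Z) (hu : u ∈ slit E M) :
    D.S (D.shift L A X) Y Z u = (1 / 2 : ℝ) •
      (A u (eta u) • D.S X Y Z u
        - (L u * ell L u (X u)) • D.S (dualField L A) Y Z u
        + (L u ^ 2) • D.S (D.T (dualField L A) X) Y Z u) := by
  have ha := hL.smoothPi_dualField hD.regular hA
  have hL2 : SmoothFn (fun p ↦ L p ^ 2) := fun u hu ↦ ContMDiffAt.pow (hL.smoothFn u hu) 2
  have hg := hL.smoothFn_metric hD.regular hX smoothPi_eta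
  have hc : SmoothFn (fun _ : TangentBundle 𝓘(ℝ, E) M ↦ (1 / 2 : ℝ)) :=
    fun _ _ ↦ contMDiffAt_const
  have hg' : SmoothFn (fun p ↦ -metric L p (X p) (eta p)) := fun u hu ↦ ContMDiffAt.neg (hg u hu)
  have h1 := smoothPi_eta.smul (hA.smoothFn hX)
  have h2 := hX.smul (hA.smoothFn smoothPi_eta)
  have h3 := ha.smul hg'
  have hT := hD.regular.smoothPi_T ha hX
  have h4 := hT.smul hL2
  have h : D.shift L A X = fun p ↦ (1 / 2 : ℝ) •
      ((fun p ↦ A p (X p) • eta p) + (fun p ↦ A p (eta p) • X p)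
        + (fun p ↦ (-metric L p (X p) (eta p)) • dualField L A p)
        + (fun p ↦ (L p ^ 2) • D.T (dualField L A) X p)) p := by
    ext1 p
    simp only [shift, Pi.add_apply, neg_smul, sub_eq_add_neg]
  rw [h, S_smul_left hc (((h1.add h2).add h3).add h4) hZ hu,
    S_add_left ((h1.add h2).add h3) h4 hZ hu, S_add_left (h1.add h2) h3 hZ hu,
    S_add_left h1 h2 hZ hu, S_smul_left (hA.smoothFn hX) smoothPi_eta hZ hu,
    S_smul_left (hA.smoothFn smoothPi_eta) hX hZ hu, S_smul_left hg' ha hZ hu,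
    S_smul_left hL2 hT hZ hu, hD.S_eta hL hY hZ hu, hL.ell_eq hu, hL.metric_symm hu (X u)]
  module

/-- Vertical fields have zero `ρ`-part, so `curvature_eq` is applied to them with the zero field in
place of `X` or `Y`; this disposes of the resulting terms. -/
lemma IsVerticallyCartan.covTensor_N_zero (hD : D.IsVerticallyCartan L) (hA : SmoothForm A)
    (hW : SmoothV W) (hZ : SmoothPi Z) (hu : u ∈ slit E M) :
    D.covTensor W (D.N L A) 0 Z u = 0 := by
  have hW0 := D.smoothPi_cov smoothPi_zero hW
  have hWZ := D.smoothPi_cov hZ hW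
  have h1 : ∀ p ∈ slit E M, D.N L A 0 Z p = 0 := fun p hp ↦ by
    rw [hD.N_eq hL hA smoothPi_zero hZ hp]
    exact hL.nTensor_zero_left hp _
  rw [covTensor, Pi.sub_apply, Pi.sub_apply, D.cov_eq_zero h1 hu, hD.N_eq hL hA hW0 hZ hu,
    hD.N_eq hL hA smoothPi_zero hWZ hu, D.cov_zero hu, hL.nTensor_zero_left hu]
  rw [show nTensor L A u ((0 : PiField E M) u) _ = 0 from hL.nTensor_zero_left hu _]
  simp

variable (hD : D.IsCartan L) (hD' : D'.IsHRF L A) (hA : SmoothForm A)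

include hD hD' hA

/-- The comparison of the curvatures of the two connections. -/
lemma curvature_eq (hV : SmoothV V) (hW : SmoothV W) (hX : SmoothPi X) (hY : SmoothPi Y)
    (hZ : SmoothPi Z) (hVX : ∀ p ∈ slit E M, rho p (V p) = X p)
    (hWY : ∀ p ∈ slit E M, rho p (W p) = Y p) (hu : u ∈ slit E M) :
    D'.curvature V W Z u = D.curvature V W Z u
      + D.covTensor W (D.N L A) X Z u - D.covTensor V (D.N L A) Y Z u
      - nTensor L A u (D.torsion V W u) (Z u)
      + nTensor L A u (Y u) (nTensor L A u (X u) (Z u))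
      - nTensor L A u (X u) (nTensor L A u (Y u) (Z u)) := by
  have := FiniteDimensional.complete ℝ E
  have hv := hD.isVerticallyCartan
  have hN : ∀ {X Y}, SmoothPi X → SmoothPi Y → D.N L A X Y u = nTensor L A u (X u) (Y u) :=
    fun hX hY ↦ hv.N_eq hL hA hX hY hu
  have key : ∀ {V W X Y}, SmoothV V → SmoothV W → SmoothPi X → SmoothPi Y →
      (∀ p ∈ slit E M, rho p (V p) = X p) → (∀ p ∈ slit E M, rho p (W p) = Y p) →
      D'.cov V (D'.cov W Z) u = D.cov V (D.cov W Z) u + D.cov V (D.N L A Y Z) u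
        + nTensor L A u (X u) (D.cov W Z u)
        + nTensor L A u (X u) (nTensor L A u (Y u) (Z u)) := by
    intro V W X Y hV hW hX hY hVX hWY
    have hWZ := D.smoothPi_cov hZ hW
    have hNY := hv.smoothPi_N hL hA hY hZ
    have h1 : ∀ p ∈ slit E M, (D.cov W Z + D.N L A Y Z) p = D'.cov W Z p := fun p hp ↦ by
      rw [Pi.add_apply, hv.N_eq hL hA hY hZ hp, ← hWY p hp]
      exact (toFun_eq hL hD hD' hZ hp (W p)).symm
    rw [← D'.cov_congr (hWZ.add hNY) rfl h1 hu]
    refine (toFun_eq hL hD hD' (hWZ.add hNY) hu (V u)).trans ?_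
    have h2 : D.toFun (D.cov W Z + D.N L A Y Z) u (V u) = _ := D.cov_add hWZ hNY hu
    rw [h2, hVX u hu, Pi.add_apply, hL.nTensor_add_right hu, hN hY hZ]
    abel
  have hb : D'.cov (VectorField.mlieBracket 𝓘(ℝ, E).tangent V W) Z u =
      D.cov (VectorField.mlieBracket 𝓘(ℝ, E).tangent V W) Z u
        + nTensor L A u (rhoF (VectorField.mlieBracket 𝓘(ℝ, E).tangent V W) u) (Z u) :=
    toFun_eq hL hD hD' hZ hu _
  -- Completing the derivatives of `N(X, Z)` and `N(Y, Z)` to covariant derivatives of the tensor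
  -- leaves `N` applied to `D_W X - D_V Y + ρ[V, W]`, which is minus the torsion.
  have htor : D.torsion V W u + rhoF (VectorField.mlieBracket 𝓘(ℝ, E).tangent V W) u
      + D.cov W X u = D.cov V Y u := by
    rw [torsion, Pi.sub_apply, Pi.sub_apply, D.cov_congr hV.rhoF rfl hVX hu,
      D.cov_congr hW.rhoF rfl hWY hu]
    abel
  have h3 := congrArg (fun x ↦ nTensor L A u x (Z u)) htor.symm
  simp only [hL.nTensor_add_left hu] at h3
  simp only [curvature, covTensor, Pi.add_apply, Pi.neg_apply, Pi.sub_apply]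
  rw [key hV hW hX hY hVX hWY, key hW hV hY hX hWY hVX, hb, hN (D.smoothPi_cov hX hW) hZ,
    hN (D.smoothPi_cov hY hV) hZ, hN hX (D.smoothPi_cov hZ hW), hN hY (D.smoothPi_cov hZ hV), h3]
  abel

lemma betaF_eq_add_shift (hX : SmoothPi X) (hu : u ∈ slit E M) :
    D'.betaF X u = D.betaF X u + gamma u (D.shift L A X u) := by
  rw [betaF_eq_betaF_add_gamma hL hD hD' hu, cov_betaF_eta hL hD hD' hX hu,
    hD.isVerticallyCartan.shift_eq hL hA hX hu]

/-- Every correction in `curvature_eq` carries `ρV`, `ρW` or the torsion of two vertical fields, all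
of which vanish. -/
lemma S_eq (hX : SmoothPi X) (hY : SmoothPi Y) (hZ : SmoothPi Z) (hu : u ∈ slit E M) :
    D'.S X Y Z u = D.S X Y Z u := by
  have hv := hD.isVerticallyCartan
  have h0 : ∀ X : PiField E M, ∀ p ∈ slit E M, rho p (gammaF X p) = (0 : PiField E M) p :=
    fun X p _ ↦ rho_gamma p _
  have htor : D.torsion (gammaF X) (gammaF Y) u = 0 := by
    have h1 : rhoF (gammaF Y) u = 0 := rho_gamma u _
    rw [hv.regular.torsion_gammaF_eq hX hY.gammaF hu, hv.T_eq_cartan hL hX hY.gammaF.rhoF hu, h1,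
      hL.cartan_zero_right hu]
  have h := curvature_eq hL hD hD' hA hX.gammaF hY.gammaF smoothPi_zero smoothPi_zero hZ (h0 X)
    (h0 Y) hu
  rw [hv.covTensor_N_zero hL hA hX.gammaF hZ hu, hv.covTensor_N_zero hL hA hY.gammaF hZ hu, htor,
    Pi.zero_apply, hL.nTensor_zero_left hu, hL.nTensor_zero_left hu] at h
  rw [S, S, h]
  abel

/-- With `ρW = 0` the quadratic terms in `N` drop out. The torsion of `β'X` and `γY` is `-T(Y, X)`,
and the vertical part of `β'X` contributes the `S`-term. -/
lemma P_eq (hX : SmoothPi X) (hY : SmoothPi Y) (hZ : SmoothPi Z) (hu : u ∈ slit E M) :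
    D'.P X Y Z u = D.P X Y Z u + D.S (D.shift L A X) Y Z u
      + D.covTensor (gammaF Y) (D.N L A) X Z u + D.N L A (D.T Y X) Z u := by
  have := FiniteDimensional.complete ℝ E
  have hv := hD.isVerticallyCartan
  have hb := hD.regular.smoothV_betaF hX
  have hb' := hD'.regular.smoothV_betaF hX
  have hs := hv.smoothPi_shift hL hA hX
  have h0 : ∀ p ∈ slit E M, rho p (gammaF Y p) = (0 : PiField E M) p :=
    fun p _ ↦ rho_gamma p _
  have hr : ∀ p ∈ slit E M, rho p (D'.betaF X p) = X p := fun p hp ↦ hD'.regular.rho_betaF hp X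
  have htor : nTensor L A u (D.torsion (D'.betaF X) (gammaF Y) u) (Z u) =
      -D.N L A (D.T Y X) Z u := by
    rw [D.torsion_swap, hv.regular.torsion_gammaF_eq hY hb' hu, hv.T_eq_cartan hL hY hb'.rhoF hu,
      rhoF, hr u hu, hv.N_eq hL hA (hv.regular.smoothPi_T hY hX) hZ hu, hv.T_eq_cartan hL hY hX hu,
      hL.nTensor_neg_left hu]
  have hK : D.curvature (D'.betaF X) (gammaF Y) Z u =
      D.P X Y Z u + D.S (D.shift L A X) Y Z u := by
    rw [← D.curvature_congr hZ (hb.add hs.gammaF) hY.gammaF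
      (fun p hp ↦ (betaF_eq_add_shift hL hD hD' hA hX hp).symm) (fun _ _ ↦ rfl) hu]
    exact D.curvature_add_left hZ hb hs.gammaF hu
  have h := curvature_eq hL hD hD' hA hb' hY.gammaF hX smoothPi_zero hZ hr h0 hu
  rw [hv.covTensor_N_zero hL hA hb' hZ hu, htor, hK, Pi.zero_apply, hL.nTensor_zero_left hu,
    hL.nTensor_zero_left hu, hL.nTensor_zero_right hu] at h
  rw [P, h]
  abel

/-- Bilinear expansion of the curvature of `D` over `β' = β + γ(·)_t` gives the `P` and `S` terms;
since `D` has no (h)h-torsion, its torsion on `β'X, β'Y` is `T(X_t, Y) - T(Y_t, X)`. -/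
lemma R_eq (hX : SmoothPi X) (hY : SmoothPi Y) (hZ : SmoothPi Z) (hu : u ∈ slit E M) :
    D'.R X Y Z u = D.R X Y Z u
      + D.P X (D.shift L A Y) Z u - D.P Y (D.shift L A X) Z u
      + D.S (D.shift L A X) (D.shift L A Y) Z u
      + ((D.covTensor (D'.betaF Y) (D.N L A) X Z u
            + D.N L A Y (D.N L A X Z) u
            + D.N L A (D.T (D.shift L A Y) X) Z u)
          - (D.covTensor (D'.betaF X) (D.N L A) Y Z u
            + D.N L A X (D.N L A Y Z) u
            + D.N L A (D.T (D.shift L A X) Y) Z u)) := by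
  have := FiniteDimensional.complete ℝ E
  have hv := hD.isVerticallyCartan
  have hr : ∀ X : PiField E M, ∀ p ∈ slit E M, rho p (D'.betaF X p) = X p :=
    fun X p hp ↦ hD'.regular.rho_betaF hp X
  have hbX := hD.regular.smoothV_betaF hX
  have hbY := hD.regular.smoothV_betaF hY
  have hsX := hv.smoothPi_shift hL hA hX
  have hsY := hv.smoothPi_shift hL hA hY
  have hN : ∀ {X Y}, SmoothPi X → SmoothPi Y → D.N L A X Y u = nTensor L A u (X u) (Y u) :=
    fun hX hY ↦ hv.N_eq hL hA hX hY hu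
  have heq : ∀ {X}, SmoothPi X → ∀ p ∈ slit E M,
      D'.betaF X p = (D.betaF X + gammaF (D.shift L A X)) p :=
    fun hX p hp ↦ betaF_eq_add_shift hL hD hD' hA hX hp
  have htor := torsion_horizontal_add_vertical hD.regular hX hY hsX hsY (heq hX) (heq hY) hu
  rw [hD.hTorsion X Y hX hY u hu, zero_add, eq_sub_iff_add_eq] at htor
  have htor' : nTensor L A u (D.torsion (D'.betaF X) (D'.betaF Y) u) (Z u) =
      D.N L A (D.T (D.shift L A X) Y) Z u - D.N L A (D.T (D.shift L A Y) X) Z u := by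
    rw [eq_sub_iff_add_eq, hN (hv.regular.smoothPi_T hsX hY) hZ,
      hN (hv.regular.smoothPi_T hsY hX) hZ, ← hL.nTensor_add_left hu, htor]
  have hK : D.curvature (D'.betaF X) (D'.betaF Y) Z u =
      D.R X Y Z u + D.P X (D.shift L A Y) Z u - D.P Y (D.shift L A X) Z u
      + D.S (D.shift L A X) (D.shift L A Y) Z u := by
    rw [← D.curvature_congr hZ (hbX.add hsX.gammaF) (hbY.add hsY.gammaF)
      (fun p hp ↦ (heq hX p hp).symm) (fun p hp ↦ (heq hY p hp).symm) hu,
      D.curvature_add_left hZ hbX hsX.gammaF hu, D.curvature_add_right hZ hbY hsY.gammaF hu,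
      D.curvature_add_right hZ hbY hsY.gammaF hu,
      D.curvature_swap (V := gammaF _) (W := D.betaF Y), R, P, P, S]
    abel
  have h := curvature_eq hL hD hD' hA (hD'.regular.smoothV_betaF hX)
    (hD'.regular.smoothV_betaF hY) hX hY hZ (hr X) (hr Y) hu
  rw [R, h, hK, htor', hN hY (hv.smoothPi_N hL hA hX hZ), hN hX (hv.smoothPi_N hL hA hY hZ),
    hN hX hZ, hN hY hZ]
  abel

end Connection

end Finsler

end

theorem mainTheorem4 {E : Type*} [NormedAddCommGroup E] [NormedSpace ℝ E] [FiniteDimensional ℝ E]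
    {M : Type*} [TopologicalSpace M] [T2Space M] [ChartedSpace E M] [IsManifold 𝓘(ℝ, E) ∞ M]
    (L : TangentBundle 𝓘(ℝ, E) M → ℝ) (hL : Finsler.IsFinsler L)
    (A : Finsler.PiForm E M) (hA : Finsler.SmoothForm A)
    (D : Finsler.Connection E M) (hD : D.IsCartan L)
    (D' : Finsler.Connection E M) (hD' : D'.IsHRF L A)
    (X Y Z : Finsler.PiField E M)
    (hX : Finsler.SmoothPi X) (hY : Finsler.SmoothPi Y) (hZ : Finsler.SmoothPi Z)
    (u : TangentBundle 𝓘(ℝ, E) M) (hu : u ∈ Finsler.slit E M) :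
    -- the fields `X_t`: `β' X = β X + γ X_t`
    D'.betaF X u = D.betaF X u + Finsler.gamma u (D.shift L A X u) ∧
    -- the v-curvature
    D'.S X Y Z u = D.S X Y Z u ∧
    -- the hv-curvature
    D'.P X Y Z u = D.P X Y Z u
      + D.covTensor (Finsler.gammaF Y) (D.N L A) X Z u
      + D.N L A (D.T Y X) Z u
      + (1 / 2 : ℝ) •
        (A u (Finsler.eta u) • D.S X Y Z u
          - (L u * Finsler.ell L u (X u)) • D.S (Finsler.dualField L A) Y Z u
          + (L u ^ 2) • D.S (D.T (Finsler.dualField L A) X) Y Z u) ∧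
    -- the h-curvature
    D'.R X Y Z u = D.R X Y Z u
      + D.P X (D.shift L A Y) Z u - D.P Y (D.shift L A X) Z u
      + D.S (D.shift L A X) (D.shift L A Y) Z u
      + ((D.covTensor (D'.betaF Y) (D.N L A) X Z u
            + D.N L A Y (D.N L A X Z) u
            + D.N L A (D.T (D.shift L A Y) X) Z u)
          - (D.covTensor (D'.betaF X) (D.N L A) Y Z u
            + D.N L A X (D.N L A Y Z) u
            + D.N L A (D.T (D.shift L A X) Y) Z u)) := by
  open Finsler Connection in
  have hv := hD.isVerticallyCartan
  refine ⟨betaF_eq_add_shift hL hD hD' hA hX hu, S_eq hL hD hD' hA hX hY hZ hu, ?_,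
    R_eq hL hD hD' hA hX hY hZ hu⟩
  rw [P_eq hL hD hD' hA hX hY hZ hu, hv.S_shift hL hA hX hY hZ hu]
  abel
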